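/- **Setting.** All complexes are finite and pure and carry a probability density on their top-level faces; a random $k$-face is obtained by sampling a top-level face $t$ and then a uniformly random $(k+1)$-subset of $t$. The link $X_s=\{t\setminus s: s\subseteq t\in X\}$ of a face $s$ carries the conditional density. An $n$-partite complex $X$ (of dimension $n-1$) has its vertices coloured by $[n]$ so that every top-level face has exactly one vertex of each colour. For $c\subseteq[n]$, $X[c]$ is the set of faces whose set of colours is $c$, and $X^c$ is the subcomplex induced on the vertices with colours in $c$, with the induced density; $X_w^I=(X_w)^I$. $X$ is a $\lambda$-(one-sided) local spectral expander if for every face $s$ (including $\emptyset$) of dimension at most $\dim X-2$, the second largest eigenvalue of the normalized adjacency operator of the weighted underlying graph of $X_s$ is at most $\lambda$. For a group $\Gamma$, $C^1(X,\Gamma)$ is the set of functions $f$ on oriented edges with $f(u,v)=f(v,u)^{-1}$; $\delta h(u,v)=h(u)h(v)^{-1}$ for $h:X(0)\to\Gamma$ and $\delta f(u,v,w)=f(u,v)f(v,w)f(w,u)$ for $f\in C^1$; $B^1=\{\delta h\}$, $Z^1=\{f:\delta f\equiv 1\}$; $\mathrm{dist}(f,g)$ is the probability that $f\neq g$ on a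 random oriented edge and $\mathrm{wt}(\delta f)$ the probability that $\delta f\ne 1$ on a random oriented triangle. We write $h^1(X)\ge\beta$ if $X$ is a $\beta$-coboundary expander: for every group $\Gamma$, $Z^1(X,\Gamma)=B^1(X,\Gamma)$, and every $f\in C^1(X,\Gamma)$ admits $g\in Z^1(X,\Gamma)$ with $\beta\,\mathrm{dist}(f,g)\le\mathrm{wt}(\delta f)$. For pairwise disjoint $c_1,\dots,c_\ell\subseteq[n]$ and $J=\{c_1,\dots,c_\ell\}$, the coloured faces complex $F^JX$ is the $\ell$-partite complex with vertex set $\bigsqcup_j X[c_j]$ (each empty $c_j$ contributes its own copy of the vertex $\emptyset$) whose random top-level face is obtained by sampling $t\in X[\bigcup_j c_j]$ and splitting it as $t=w_1\sqcup\dots\sqcup w_\ell$ with $w_j\in X[c_j]$. **Proposition.** For every $\ell\ge5$ there is a constant $C=C(\ell)>0$ such that the following holds. Let $X$ be an $n$-partite complex that is a $\lambda$-local spectral expander, let $r\ge 0$ be an integer with $2r^2\lambda\le 1$ (that is, $\lambda\le\frac1{2r^2}$ when $r\ge1$), let $J=\{c_1,\dots,c_\ell\}$ with $c_j\subseteq[n]$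 pairwise disjoint (possibly empty) and $|c_j|\le r$, and put $R=\sum_{j=1}^{\ell}|c_j|$. Let $\beta>0$, where $\beta\le1$ if some $c_j$ is empty. Assume that $h^1(X_w^I)\ge\beta$ for every $I=\{i_1,\dots,i_\ell\}$ with $i_j\in c_j$ and every face $w\in X^{\bigcup J\setminus I}$ (that is, every face $w$ of $X$, including $\emptyset$, all of whose colours lie in $\bigcup_j c_j\setminus I$). Then $h^1(F^JX)\ge\beta_1^{R}$ with $\beta_1=C\beta$. -/

import Mathlib

universe u v

/-- A finite simplicial complex with a probability distribution on its top-level faces: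
`weight t` is the probability of the top-level face `t`, and the faces of the complex are the
subsets of the sets of positive weight.  The complex is pure of dimension `d` when every set of
positive weight has `d + 1` elements; this is so for all complexes occurring below. -/
structure WeightedComplex (V : Type v) [Fintype V] where
  weight : Finset V → ℝ
  weight_nonneg : ∀ t, 0 ≤ weight t
  sum_weight : ∑ t, weight t = 1

namespace WeightedComplex

section General

variable {V : Type v} [Fintype V] (X : WeightedComplex V)

/-- `s` is a face of `X` (the empty set is always one). -/
def IsFace (s : Finset V) : Prop := ∃ t, 0 < X.weight t ∧ s ⊆ t

open Classical in
/-- The total weight of the top-level faces that contain `s`. -/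
noncomputable def upWeight (s : Finset V) : ℝ := ∑ t, if s ⊆ t then X.weight t else 0

theorem upWeight_pos {s : Finset V} (hs : X.IsFace s) : 0 < X.upWeight s := by
  classical
  obtain ⟨t, ht, hst⟩ := hs
  refine Finset.sum_pos' (fun a _ => ?_) ⟨t, Finset.mem_univ t, ?_⟩
  · split_ifs
    · exact X.weight_nonneg a
    · exact le_rfl
  · simpa [hst] using ht

open Classical in
/-- The induced density `Pr_k` on the faces with `k + 1 = s.card` elements: sample a top-level
face `t`, then a uniformly random subset of `t` of that size. -/
noncomputable def prob (s : Finset V) : ℝ :=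
  ∑ t, if s ⊆ t then X.weight t / (t.card.choose s.card : ℝ) else 0

open Classical in
/-- The link `X_s` of a face `s`, with the induced (conditional) distribution. -/
noncomputable def link (s : Finset V) (hs : X.IsFace s) : WeightedComplex V where
  weight t := if Disjoint t s then X.weight (t ∪ s) / X.upWeight s else 0
  weight_nonneg t := by
    split_ifs
    · exact div_nonneg (X.weight_nonneg _) (X.upWeight_pos hs).le
    · exact le_rfl
  sum_weight := by
    have h : (∑ t, if Disjoint t s then X.weight (t ∪ s) else 0) = X.upWeight s := by
      unfold upWeight
      rw [← Finset.sum_filter, ← Finset.sum_filter]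
      refine Finset.sum_nbij' (fun t => t ∪ s) (fun t => t \ s) ?_ ?_ ?_ ?_ ?_
      · intro t _
        simp
      · intro t _
        simpa using Finset.sdiff_disjoint
      · intro t ht
        have ht' : Disjoint t s := by simpa using ht
        simp only [Finset.union_sdiff_right]
        exact ht'.sdiff_eq_left
      · intro t ht
        have ht' : s ⊆ t := by simpa using ht
        simpa using ht'
      · intro t _
        rfl
    have h2 : (∑ t, if Disjoint t s then X.weight (t ∪ s) / X.upWeight s else 0)
        = (∑ t, if Disjoint t s then X.weight (t ∪ s) else 0) / X.upWeight s := by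
      rw [Finset.sum_div]
      refine Finset.sum_congr rfl fun t _ => ?_
      split_ifs <;> simp
    rw [h2, h, div_self (X.upWeight_pos hs).ne']

open Classical in
/-- The complex whose top-level faces are the sets `φ t`, where `t` is sampled from `X`. -/
noncomputable def map {W : Type v} [Fintype W] (φ : Finset V → Finset W) :
    WeightedComplex W where
  weight s := ∑ t, if φ t = s then X.weight t else 0
  weight_nonneg s := by
    refine Finset.sum_nonneg fun t _ => ?_
    split_ifs
    · exact X.weight_nonneg t
    · exact le_rfl
  sum_weight := by
    rw [Finset.sum_comm]
    simpa using X.sum_weight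

/-! ### Spectral expansion -/

open Classical in
/-- The distribution on the edges of the underlying graph. -/
noncomputable def edgeProb (a b : V) : ℝ := if a ≠ b then X.prob {a, b} else 0

/-- The distribution on the vertices of the underlying graph. -/
noncomputable def vertexProb (a : V) : ℝ := (1 / 2) * ∑ b, X.edgeProb a b

/-- The normalized adjacency operator of the underlying graph. -/
noncomputable def adjOp (f : V → ℝ) (a : V) : ℝ :=
  1 / (2 * X.vertexProb a) * ∑ b, X.edgeProb a b * f b

/-- The second largest eigenvalue of the underlying graph is at most `lam`.  The adjacency operator
is self-adjoint for the inner product weighted by `vertexProb`, and its largest eigenvalue `1` is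
attained at the constants, so its second largest eigenvalue (with multiplicity) is the largest
one with an eigenvector orthogonal to the constants.  Functions are considered on the vertices
of the graph only. -/
def SecondEigenvalueLE (lam : ℝ) : Prop :=
  ∀ (θ : ℝ) (f : V → ℝ),
    (∃ a, 0 < X.vertexProb a ∧ f a ≠ 0) →
    (∀ a, 0 < X.vertexProb a → X.adjOp f a = θ * f a) →
    ∑ a, X.vertexProb a * f a = 0 →
    θ ≤ lam

/-- `X`, whose top-level faces have `m` vertices (dimension `m - 1`), is a `lam`-one-sided local
spectral expander: the links of all faces of dimension at most `(m - 1) - 2`, including the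
empty face, have second largest eigenvalue at most `lam`. -/
def IsLocalSpectralExpander (m : ℕ) (lam : ℝ) : Prop :=
  ∀ (s : Finset V) (hs : X.IsFace s), s.card + 2 ≤ m → (X.link s hs).SecondEigenvalueLE lam

/-! ### Cochains and coboundary expansion -/

open Classical in
/-- `(a, b)` is an oriented edge. -/
def IsEdge (a b : V) : Prop := a ≠ b ∧ X.IsFace {a, b}

open Classical in
/-- `(a, b, c)` is an oriented triangle. -/
def IsTriangle (a b c : V) : Prop := a ≠ b ∧ b ≠ c ∧ a ≠ c ∧ X.IsFace {a, b, c}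

/-- `f ∈ C¹(X, Γ)`; values off the oriented edges play no role. -/
def IsCochain {Γ : Type u} [Group Γ] (f : V → V → Γ) : Prop :=
  ∀ a b, X.IsEdge a b → f a b = (f b a)⁻¹

/-- `δ₁ f (a, b, c)`. -/
def delta {Γ : Type u} [Group Γ] (f : V → V → Γ) (a b c : V) : Γ := f a b * f b c * f c a

/-- `f ∈ Z¹(X, Γ)`. -/
def IsCocycle {Γ : Type u} [Group Γ] (f : V → V → Γ) : Prop :=
  X.IsCochain f ∧ ∀ a b c, X.IsTriangle a b c → delta f a b c = 1

/-- `f ∈ B¹(X, Γ)`, that is `f = δ₀ h` on the oriented edges. -/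
def IsCoboundary {Γ : Type u} [Group Γ] (f : V → V → Γ) : Prop :=
  ∃ h : V → Γ, ∀ a b, X.IsEdge a b → f a b = h a * (h b)⁻¹

open Classical in
/-- The probability that `f` and `g` differ on a random oriented edge. -/
noncomputable def dist {Γ : Type u} (f g : V → V → Γ) : ℝ :=
  ∑ a, ∑ b, if X.IsEdge a b ∧ f a b ≠ g a b then X.prob {a, b} / 2 else 0

open Classical in
/-- The weight of `δ₁ f`: the probability that it is not the identity on a random oriented
triangle. -/
noncomputable def deltaWeight {Γ : Type u} [Group Γ] (f : V → V → Γ) : ℝ :=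
  ∑ a, ∑ b, ∑ c,
    if X.IsTriangle a b c ∧ delta f a b c ≠ 1 then X.prob {a, b, c} / 6 else 0

/-- `β`-cosystolic expansion (for `1`-cochains, over every group). -/
def IsCosystolicExpander (β : ℝ) : Prop :=
  ∀ (Γ : Type u) [Group Γ] (f : V → V → Γ), X.IsCochain f →
    ∃ g : V → V → Γ, X.IsCocycle g ∧ β * X.dist f g ≤ X.deltaWeight f

/-- `β`-coboundary expansion (for `1`-cochains, over every group): `β`-cosystolic expansion and
`Z¹ = B¹`. -/
def IsCoboundaryExpander (β : ℝ) : Prop :=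
  IsCosystolicExpander.{u} X β ∧
    ∀ (Γ : Type u) [Group Γ] (f : V → V → Γ), X.IsCocycle f ↔ X.IsCoboundary f

end General

/-! ### Partite complexes -/

section Partite

variable {V : Type v} [Fintype V] (X : WeightedComplex V) {n : ℕ} (col : V → Fin n)

/-- `X` is `n`-partite (of dimension `n - 1`) with colouring `col`: every top-level face has
exactly one vertex of each colour. -/
def IsPartite : Prop :=
  ∀ t, 0 < X.weight t → ∀ i : Fin n, ∃! a, a ∈ t ∧ col a = i

/-- The colour restriction `X^c`: the complex induced on the vertices with colours in `c`, with
the induced distribution. -/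
noncomputable def restrict (c : Finset (Fin n)) : WeightedComplex V :=
  X.map fun t => t.filter fun a => col a ∈ c

open Classical in
/-- The coloured faces complex `F^J X` for `J = {c 0, …, c (ℓ - 1)}`.  A vertex `(j, w)` stands for
a face `w` of colour `c j`; the tag `j` matters only for empty `c j`, each of which contributes
its own copy of the vertex `∅`.  A random top-level face is obtained by sampling `t` and splitting
its restriction to the colours `⋃ j, c j` into the parts of colours `c j`. -/
noncomputable def facesComplex {ℓ : ℕ} (c : Fin ℓ → Finset (Fin n)) :
    WeightedComplex (Fin ℓ × Finset V) :=
  X.map fun t => Finset.univ.image fun j : Fin ℓ => (j, t.filter fun a => col a ∈ c j)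

end Partite

end WeightedComplex

/-! A cochain on `F^J X` is read as a system `F j k` of group-valued functions of a random top-level
face `t`, where `F j k` sees only the colours in `c j ∪ c k`. Once the vertices with colours in a
set `T` are fixed, potentials come for free as soon as `T` contains some `c m`: the cone `k ↦ F k m`
is an approximate potential, at the price of depending on the colours in `T` (`isPotentialAt_apex`).
A downward recursion on `T` removes this price; at `T = ∅` the `j`-th potential depends on `c j`
alone, so it is a 0-cochain of `F^J X`.

For the recursive step (`IsPotentialAt.extend`), let `T` contain no `c j`, choose `i j ∈ c j \ T`,
and let `h_j` be the potentials over `T ∪ {i j}`. The discrepancy `h_j(m)⁻¹ h_k(m)` is nearly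
independent of `m`: comparison with the family over `T ∪ {i j, i k}` shows that it is close to a
function `φ j k` of the colours `T ∪ {i j, i k}` only. Hence `φ` is an approximate cocycle on the
complexes `X_w^I`, with `w` of colours `T`, and their expansion gives `φ j k ≈ H_j H_k⁻¹` with `H_j`
depending on `T ∪ {i j}` (`IsPartite.exists_potential`). Now `h_j(m) H_j` is nearly the same for all
`j`; taking `j = m` gives a potential that depends on `T ∪ c m` only.

Each colour removed costs a factor `K = O(1/β)` in the error, and there are `R` of them. The
remaining loss depends on `ℓ` only and is absorbed into the constant when `R ≥ 1`; for `R = 0` the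
faces complex is a simplex, where coning loses nothing. -/

namespace WeightedComplex

/-! ### Probabilities of events for a random top-level face. -/

section Probability

variable {V : Type v} [Fintype V] (X : WeightedComplex V)

open Classical in
/-- The probability that a random top-level face satisfies `p`. -/
noncomputable def pr (p : Finset V → Prop) : ℝ := ∑ t, if p t then X.weight t else 0

theorem pr_nonneg (p : Finset V → Prop) : 0 ≤ X.pr p :=
  Finset.sum_nonneg fun t _ => by
    split_ifs
    · exact X.weight_nonneg t
    · exact le_rfl

theorem pr_mono {p q : Finset V → Prop} (h : ∀ t, 0 < X.weight t → p t → q t) :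
    X.pr p ≤ X.pr q := by
  refine Finset.sum_le_sum fun t _ => ?_
  rcases (X.weight_nonneg t).eq_or_lt with h0 | h0
  · simp [← h0]
  · by_cases hp : p t
    · simp [hp, h t h0 hp]
    · simp only [hp, if_false]
      split_ifs
      · exact h0.le
      · exact le_rfl

theorem pr_congr {p q : Finset V → Prop} (h : ∀ t, 0 < X.weight t → (p t ↔ q t)) :
    X.pr p = X.pr q :=
  le_antisymm (X.pr_mono fun t ht => (h t ht).1) (X.pr_mono fun t ht => (h t ht).2)

theorem pr_false : X.pr (fun _ => False) = 0 := by simp [pr]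

theorem pr_true : X.pr (fun _ => True) = 1 := by simp [pr, X.sum_weight]

theorem pr_eq_zero {p : Finset V → Prop} (h : ∀ t, 0 < X.weight t → ¬ p t) : X.pr p = 0 := by
  rw [← X.pr_false]
  exact X.pr_congr fun t ht => ⟨fun hp => h t ht hp, False.elim⟩

theorem pr_le_add {p q r : Finset V → Prop} (h : ∀ t, 0 < X.weight t → p t → q t ∨ r t) :
    X.pr p ≤ X.pr q + X.pr r := by
  refine (X.pr_mono h).trans ?_
  rw [pr, pr, pr, ← Finset.sum_add_distrib]
  refine Finset.sum_le_sum fun t _ => ?_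
  have := X.weight_nonneg t
  by_cases hq : q t <;> by_cases hr : r t <;> simp [hq, hr, this]

theorem pr_fiberwise {W : Type*} [Fintype W] (g : Finset V → W) (p : Finset V → Prop) :
    X.pr p = ∑ w, X.pr fun t => g t = w ∧ p t := by
  classical
  unfold pr
  rw [Finset.sum_comm]
  refine Finset.sum_congr rfl fun t _ => ?_
  by_cases hp : p t <;> simp [hp]

theorem exists_weight_pos : ∃ t, 0 < X.weight t := by
  by_contra! h
  have : ∑ t, X.weight t ≤ 0 := Finset.sum_nonpos fun t _ => h t
  linarith [X.sum_weight]

open Classical in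
theorem link_pr (w : Finset V) (hw : X.IsFace w) (p : Finset V → Prop) :
    (X.link w hw).pr p = X.pr (fun t => w ⊆ t ∧ p (t \ w)) / X.upWeight w := by
  unfold pr link
  rw [Finset.sum_div]
  simp only [ite_div, zero_div, ← ite_and]
  rw [← Finset.sum_filter (p := fun t => p t ∧ Disjoint t w),
    ← Finset.sum_filter (p := fun t => w ⊆ t ∧ p (t \ w))]
  refine Finset.sum_nbij' (fun t => t ∪ w) (fun t => t \ w) ?_ ?_ ?_ ?_ ?_
  · intro t ht
    simp only [Finset.mem_filter, Finset.mem_univ, true_and] at ht ⊢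
    refine ⟨Finset.subset_union_right, ?_⟩
    rw [Finset.union_sdiff_right, ht.2.sdiff_eq_left]
    exact ht.1
  · intro t ht
    simp only [Finset.mem_filter, Finset.mem_univ, true_and] at ht ⊢
    exact ⟨ht.2, Finset.sdiff_disjoint⟩
  · intro t ht
    simp only [Finset.mem_filter, Finset.mem_univ, true_and] at ht
    simp only [Finset.union_sdiff_right]
    exact ht.2.sdiff_eq_left
  · intro t ht
    simp only [Finset.mem_filter, Finset.mem_univ, true_and] at ht
    exact Finset.sdiff_union_of_subset ht.1
  · intro t _
    congr!

open Classical in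
theorem link_weight_pos {w : Finset V} {hw : X.IsFace w} {t : Finset V}
    (h : 0 < (X.link w hw).weight t) : Disjoint t w ∧ 0 < X.weight (t ∪ w) := by
  simp only [link] at h
  split_ifs at h with hd
  · exact ⟨hd, (div_pos_iff_of_pos_right (X.upWeight_pos hw)).1 h⟩
  · exact absurd h (lt_irrefl _)

end Probability

/-! ### Distance and coboundary weight in an image complex, as sums over indices. -/

section Map

variable {V W : Type v} [Fintype V] [Fintype W] (X : WeightedComplex V)
  {φ : Finset V → Finset W} {ℓ : ℕ} {e : Finset V → Fin ℓ → W}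

theorem sum_map_weight_mul (φ : Finset V → Finset W) (G : Finset W → ℝ) :
    ∑ s, (X.map φ).weight s * G s = ∑ t, X.weight t * G (φ t) := by
  classical
  simp only [map, Finset.sum_mul]
  rw [Finset.sum_comm]
  refine Finset.sum_congr rfl fun t _ => ?_
  simp

theorem map_isFace_iff {s : Finset W} :
    (X.map φ).IsFace s ↔ ∃ t, 0 < X.weight t ∧ s ⊆ φ t := by
  classical
  constructor
  · rintro ⟨s', hs', hss⟩
    obtain ⟨t, -, ht⟩ := Finset.exists_ne_zero_of_sum_ne_zero (by simpa [map] using hs'.ne')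
    split_ifs at ht with h
    · exact ⟨t, (X.weight_nonneg t).lt_of_ne' ht, h ▸ hss⟩
    · exact absurd rfl ht
  · rintro ⟨t, ht, hst⟩
    refine ⟨φ t, ?_, hst⟩
    refine Finset.sum_pos' (fun a _ => ?_) ⟨t, Finset.mem_univ t, by simpa using ht⟩
    split_ifs
    · exact X.weight_nonneg a
    · exact le_rfl

/-- Injectivity of `e t` gives every image face exactly `ℓ` elements, so the binomial factor is
constant. -/
theorem prob_map [DecidableEq W]
    (hφ : ∀ t, 0 < X.weight t → Function.Injective (e t) ∧ φ t = Finset.univ.image (e t))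
    (s : Finset W) :
    (X.map φ).prob s = X.pr (fun t => s ⊆ φ t) / (ℓ.choose s.card : ℝ) := by
  classical
  have h := X.sum_map_weight_mul φ
    (fun s' => if s ⊆ s' then 1 / (s'.card.choose s.card : ℝ) else 0)
  have h' : (X.map φ).prob s = ∑ s', (X.map φ).weight s'
      * (if s ⊆ s' then 1 / (s'.card.choose s.card : ℝ) else 0) := by
    refine Finset.sum_congr rfl fun t _ => ?_
    split_ifs <;> simp [div_eq_mul_inv]
  rw [h', h, pr, Finset.sum_div]
  simp only [mul_ite, mul_zero, mul_one_div]
  refine Finset.sum_congr rfl fun t _ => ?_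
  rcases (X.weight_nonneg t).eq_or_lt with h0 | h0
  · simp [← h0]
  · have : (φ t).card = ℓ := by
      rw [(hφ t h0).2, Finset.card_image_of_injective _ (hφ t h0).1]; simp
    rw [this]
    split_ifs <;> simp

theorem sum_comm_pair {A B : Type*} [Fintype A] [Fintype B] (G : A → A → B → ℝ) :
    ∑ a, ∑ b, ∑ t, G a b t = ∑ t, ∑ a, ∑ b, G a b t :=
  (Finset.sum_congr rfl fun _ _ => Finset.sum_comm).trans Finset.sum_comm

theorem sum_comm_triple {A B : Type*} [Fintype A] [Fintype B] (G : A → A → A → B → ℝ) :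
    ∑ a, ∑ b, ∑ c, ∑ t, G a b c t = ∑ t, ∑ a, ∑ b, ∑ c, G a b c t :=
  (Finset.sum_congr rfl fun _ _ => sum_comm_pair _).trans Finset.sum_comm

theorem sum_pr_subset_pair [DecidableEq W]
    (hφ : ∀ t, 0 < X.weight t → Function.Injective (e t) ∧ φ t = Finset.univ.image (e t))
    (p : W → W → Prop) :
    ∑ a, ∑ b, X.pr (fun t => {a, b} ⊆ φ t ∧ a ≠ b ∧ p a b)
      = ∑ j, ∑ k, X.pr (fun t => j ≠ k ∧ p (e t j) (e t k)) := by
  classical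
  unfold pr
  rw [sum_comm_pair, sum_comm_pair]
  refine Finset.sum_congr rfl fun t _ => ?_
  rcases (X.weight_nonneg t).eq_or_lt with h0 | h0
  · simp [← h0]
  obtain ⟨hi, him⟩ := hφ t h0
  have key : ∀ G : W → ℝ, (∑ a, if a ∈ φ t then G a else 0) = ∑ j, G (e t j) := by
    intro G
    rw [← Finset.sum_filter, Finset.filter_mem_eq_inter, Finset.univ_inter, him,
      Finset.sum_image hi.injOn]
  have hpull : ∀ (P : Prop) [Decidable P] (G : W → ℝ),
      (∑ a, if P then G a else 0) = if P then ∑ a, G a else 0 := by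
    intro P _ G; split_ifs <;> simp
  trans ∑ a, ∑ b, if a ∈ φ t then (if b ∈ φ t then
    (if a ≠ b ∧ p a b then X.weight t else 0) else 0) else 0
  · refine Finset.sum_congr rfl fun a _ => Finset.sum_congr rfl fun b _ => ?_
    simp only [Finset.insert_subset_iff, Finset.singleton_subset_iff, ← ite_and, and_assoc]
  · simp only [hpull]
    simp only [key, hi.ne_iff]
    congr!

theorem sum_pr_subset_triple [DecidableEq W]
    (hφ : ∀ t, 0 < X.weight t → Function.Injective (e t) ∧ φ t = Finset.univ.image (e t))
    (p : W → W → W → Prop) :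
    ∑ a, ∑ b, ∑ c, X.pr (fun t => {a, b, c} ⊆ φ t ∧ (a ≠ b ∧ b ≠ c ∧ a ≠ c) ∧ p a b c)
      = ∑ j, ∑ k, ∑ m, X.pr (fun t => (j ≠ k ∧ k ≠ m ∧ j ≠ m) ∧ p (e t j) (e t k) (e t m)) := by
  classical
  unfold pr
  rw [sum_comm_triple, sum_comm_triple]
  refine Finset.sum_congr rfl fun t _ => ?_
  rcases (X.weight_nonneg t).eq_or_lt with h0 | h0
  · simp [← h0]
  obtain ⟨hi, him⟩ := hφ t h0
  have key : ∀ G : W → ℝ, (∑ a, if a ∈ φ t then G a else 0) = ∑ j, G (e t j) := by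
    intro G
    rw [← Finset.sum_filter, Finset.filter_mem_eq_inter, Finset.univ_inter, him,
      Finset.sum_image hi.injOn]
  have hpull : ∀ (P : Prop) [Decidable P] (G : W → ℝ),
      (∑ a, if P then G a else 0) = if P then ∑ a, G a else 0 := by
    intro P _ G; split_ifs <;> simp
  trans ∑ a, ∑ b, ∑ c, if a ∈ φ t then (if b ∈ φ t then (if c ∈ φ t then
    (if (a ≠ b ∧ b ≠ c ∧ a ≠ c) ∧ p a b c then X.weight t else 0) else 0) else 0) else 0
  · refine Finset.sum_congr rfl fun a _ => Finset.sum_congr rfl fun b _ =>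
      Finset.sum_congr rfl fun c _ => ?_
    simp only [Finset.insert_subset_iff, Finset.singleton_subset_iff, ← ite_and, and_assoc]
  · simp only [hpull]
    simp only [key, hi.ne_iff]
    congr!

theorem dist_map {Γ : Type u} [Group Γ]
    (hφ : ∀ t, 0 < X.weight t → Function.Injective (e t) ∧ ∀ a, a ∈ φ t ↔ ∃ j, e t j = a)
    (f g : W → W → Γ) :
    (X.map φ).dist f g
      = (∑ j, ∑ k, X.pr fun t => j ≠ k ∧ f (e t j) (e t k) ≠ g (e t j) (e t k))
        / ((ℓ.choose 2 : ℝ) * 2) := by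
  classical
  have hφ' : ∀ t, 0 < X.weight t → Function.Injective (e t) ∧ φ t = Finset.univ.image (e t) :=
    fun t ht => ⟨(hφ t ht).1, by ext a; simp [(hφ t ht).2]⟩
  rw [← X.sum_pr_subset_pair hφ' fun a b => f a b ≠ g a b, dist, Finset.sum_div]
  refine Finset.sum_congr rfl fun a _ => ?_
  rw [Finset.sum_div]
  refine Finset.sum_congr rfl fun b _ => ?_
  by_cases hab : a ≠ b ∧ f a b ≠ g a b
  · have h1 : X.pr (fun t => {a, b} ⊆ φ t ∧ a ≠ b ∧ f a b ≠ g a b)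
        = X.pr (fun t => {a, b} ⊆ φ t) := X.pr_congr fun t _ => by simp [hab]
    rw [h1]
    split_ifs with h
    · rw [X.prob_map hφ', Finset.card_pair hab.1, div_div]
    · rw [X.pr_eq_zero, zero_div]
      intro t ht hs
      refine h ⟨⟨hab.1, X.map_isFace_iff.2 ⟨t, ht, ?_⟩⟩, hab.2⟩
      convert hs
  · rw [X.pr_eq_zero (fun t _ h => hab h.2), zero_div, if_neg]
    rintro ⟨h, h'⟩
    exact hab ⟨h.1, h'⟩

theorem deltaWeight_map {Γ : Type u} [Group Γ]
    (hφ : ∀ t, 0 < X.weight t → Function.Injective (e t) ∧ ∀ a, a ∈ φ t ↔ ∃ j, e t j = a)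
    (f : W → W → Γ) :
    (X.map φ).deltaWeight f
      = (∑ j, ∑ k, ∑ m, X.pr fun t => (j ≠ k ∧ k ≠ m ∧ j ≠ m)
          ∧ delta f (e t j) (e t k) (e t m) ≠ 1) / ((ℓ.choose 3 : ℝ) * 6) := by
  classical
  have hφ' : ∀ t, 0 < X.weight t → Function.Injective (e t) ∧ φ t = Finset.univ.image (e t) :=
    fun t ht => ⟨(hφ t ht).1, by ext a; simp [(hφ t ht).2]⟩
  rw [← X.sum_pr_subset_triple hφ' fun a b c => delta f a b c ≠ 1, deltaWeight, Finset.sum_div]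
  refine Finset.sum_congr rfl fun a _ => ?_
  rw [Finset.sum_div]
  refine Finset.sum_congr rfl fun b _ => ?_
  rw [Finset.sum_div]
  refine Finset.sum_congr rfl fun c _ => ?_
  by_cases hab : (a ≠ b ∧ b ≠ c ∧ a ≠ c) ∧ delta f a b c ≠ 1
  · have h1 : X.pr (fun t => {a, b, c} ⊆ φ t ∧ (a ≠ b ∧ b ≠ c ∧ a ≠ c) ∧ delta f a b c ≠ 1)
        = X.pr (fun t => {a, b, c} ⊆ φ t) := X.pr_congr fun t _ => by simp [hab]
    rw [h1]
    split_ifs with h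
    · rw [X.prob_map hφ', Finset.card_eq_three.2 ⟨a, b, c, hab.1.1, hab.1.2.2, hab.1.2.1, ?_⟩,
        div_div]
      congr!
    · rw [X.pr_eq_zero, zero_div]
      intro t ht hs
      refine h ⟨⟨hab.1.1, hab.1.2.1, hab.1.2.2, X.map_isFace_iff.2 ⟨t, ht, ?_⟩⟩, hab.2⟩
      convert hs
  · rw [X.pr_eq_zero (fun t _ h => hab h.2), zero_div, if_neg]
    rintro ⟨h, h'⟩
    exact hab ⟨⟨h.1, h.2.1, h.2.2.1⟩, h'⟩

end Map

/-! ### Coboundary expansion as one inequality. -/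

section Expansion

variable {V : Type v} [Fintype V] (X : WeightedComplex V)

theorem IsEdge.symm {a b : V} (h : X.IsEdge a b) : X.IsEdge b a :=
  ⟨h.1.symm, by classical exact Finset.pair_comm a b ▸ h.2⟩

theorem IsTriangle.isEdge {a b c : V} (h : X.IsTriangle a b c) :
    X.IsEdge a b ∧ X.IsEdge b c ∧ X.IsEdge c a := by
  classical
  obtain ⟨hab, hbc, hac, t, ht, hs⟩ := h
  simp only [Finset.insert_subset_iff, Finset.singleton_subset_iff] at hs
  refine ⟨⟨hab, t, ht, ?_⟩, ⟨hbc, t, ht, ?_⟩, ⟨hac.symm, t, ht, ?_⟩⟩ <;>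
    simp [Finset.insert_subset_iff, hs]

theorem prob_pos {s : Finset V} (hs : X.IsFace s) : 0 < X.prob s := by
  classical
  obtain ⟨t, ht, hst⟩ := hs
  refine Finset.sum_pos' (fun a _ => ?_) ⟨t, Finset.mem_univ t, ?_⟩
  · split_ifs
    · exact div_nonneg (X.weight_nonneg _) (Nat.cast_nonneg _)
    · exact le_rfl
  · rw [if_pos hst]
    exact div_pos ht (Nat.cast_pos.2 (Nat.choose_pos (Finset.card_le_card hst)))

theorem dist_congr_right {Γ : Type u} {f g g' : V → V → Γ}
    (h : ∀ a b, X.IsEdge a b → g a b = g' a b) : X.dist f g = X.dist f g' := by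
  classical
  refine Finset.sum_congr rfl fun a _ => Finset.sum_congr rfl fun b _ => ?_
  by_cases hab : X.IsEdge a b
  · simp [hab, h a b hab]
  · simp [hab]

theorem IsCoboundary.isCocycle {Γ : Type u} [Group Γ] {f : V → V → Γ} (hf : X.IsCoboundary f) :
    X.IsCocycle f := by
  obtain ⟨h, hh⟩ := hf
  refine ⟨fun a b hab => ?_, fun a b c habc => ?_⟩
  · rw [hh a b hab, hh b a (IsEdge.symm X hab)]; group
  · obtain ⟨h1, h2, h3⟩ := IsTriangle.isEdge X habc
    rw [delta, hh _ _ h1, hh _ _ h2, hh _ _ h3]; group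

theorem eq_on_edges_of_dist_nonpos {Γ : Type u} {f g : V → V → Γ} (h : X.dist f g ≤ 0)
    {a b : V} (hab : X.IsEdge a b) : f a b = g a b := by
  classical
  by_contra hne
  refine absurd h (not_le.2 ?_)
  have hnn : ∀ a b, 0 ≤ (if X.IsEdge a b ∧ f a b ≠ g a b then X.prob {a, b} / 2 else 0) := by
    intro a b
    split_ifs with h
    · exact div_nonneg (X.prob_pos h.1.2).le zero_le_two
    · exact le_rfl
  refine Finset.sum_pos' (fun a _ => Finset.sum_nonneg fun b _ => hnn a b)
    ⟨a, Finset.mem_univ a, Finset.sum_pos' (fun b _ => hnn a b) ⟨b, Finset.mem_univ b, ?_⟩⟩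
  rw [if_pos ⟨hab, hne⟩]
  exact div_pos (X.prob_pos hab.2) zero_lt_two

/-- A cocycle has coboundary weight zero, so for positive `β` the inequality puts it at distance
zero from a coboundary; every edge has positive probability, so the two agree on all edges. -/
theorem isCoboundaryExpander_iff {β : ℝ} (hβ : 0 < β) :
    IsCoboundaryExpander.{u} X β ↔ ∀ (Γ : Type u) [Group Γ] (f : V → V → Γ), X.IsCochain f →
      ∃ h : V → Γ, β * X.dist f (fun a b => h a * (h b)⁻¹) ≤ X.deltaWeight f := by
  classical
  constructor
  · rintro ⟨h1, h2⟩ Γ _ f hf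
    obtain ⟨g, hg, hd⟩ := h1 Γ f hf
    obtain ⟨h, hh⟩ := (h2 Γ g).1 hg
    exact ⟨h, by rwa [← X.dist_congr_right hh]⟩
  · intro H
    refine ⟨fun Γ _ f hf => ?_, fun Γ _ f => ⟨fun hf => ?_, fun hf => hf.isCocycle X⟩⟩
    · obtain ⟨h, hh⟩ := H Γ f hf
      exact ⟨_, IsCoboundary.isCocycle X ⟨h, fun _ _ _ => rfl⟩, hh⟩
    · obtain ⟨h, hh⟩ := H Γ f hf.1
      have h0 : X.deltaWeight f = 0 := by
        refine Finset.sum_eq_zero fun a _ => Finset.sum_eq_zero fun b _ =>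
          Finset.sum_eq_zero fun c _ => if_neg ?_
        rintro ⟨ht, hne⟩
        exact hne (hf.2 a b c ht)
      rw [h0] at hh
      refine ⟨h, fun a b hab => X.eq_on_edges_of_dist_nonpos
        (g := fun a b => h a * (h b)⁻¹) ?_ hab⟩
      by_contra hpos
      exact absurd hh (not_le.2 (mul_pos hβ (not_le.1 hpos)))

end Expansion

/-! ### Counts of ordered pairs and triples. -/

section Choose

variable {ℓ : ℕ}

theorem one_le_choose_two_mul (hℓ : 3 ≤ ℓ) : (1 : ℝ) ≤ (ℓ.choose 2 : ℝ) * 2 := by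
  have h : 1 ≤ ℓ.choose 2 := Nat.choose_pos (by omega)
  have : (1 : ℝ) ≤ (ℓ.choose 2 : ℝ) := by exact_mod_cast h
  linarith

theorem one_le_choose_three_mul (hℓ : 3 ≤ ℓ) : (1 : ℝ) ≤ (ℓ.choose 3 : ℝ) * 6 := by
  have h : 1 ≤ ℓ.choose 3 := Nat.choose_pos hℓ
  have : (1 : ℝ) ≤ (ℓ.choose 3 : ℝ) := by exact_mod_cast h
  linarith

theorem choose_two_mul_le (ℓ : ℕ) : (ℓ.choose 2 : ℝ) * 2 ≤ (ℓ : ℝ) ^ 2 := by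
  rw [Nat.cast_choose_two]
  nlinarith [Nat.cast_nonneg (α := ℝ) ℓ]

theorem choose_three_mul_le (ℓ : ℕ) : (ℓ.choose 3 : ℝ) * 6 ≤ (ℓ : ℝ) * ((ℓ.choose 2 : ℝ) * 2) := by
  have h : ℓ.choose 3 * 3 ≤ ℓ.choose 2 * ℓ := by
    rw [Nat.choose_succ_right_eq ℓ 2]
    exact Nat.mul_le_mul_left _ (Nat.sub_le _ _)
  have : (ℓ.choose 3 : ℝ) * 3 ≤ (ℓ.choose 2 : ℝ) * ℓ := by exact_mod_cast h
  linarith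

end Choose

/-! ### Functions of a face that see only some of its colours. -/

section Colors

variable {V : Type v} {n : ℕ} (col : V → Fin n)

/-- The part of `t` with colours in `S`. -/
def proj (S : Finset (Fin n)) (t : Finset V) : Finset V := t.filter fun a => col a ∈ S

/-- The value `g t` depends only on the vertices of `t` with colours in `S`. -/
def DependsOnColors {Γ : Type*} (S : Finset (Fin n)) (g : Finset V → Γ) : Prop :=
  ∀ t, g (proj col S t) = g t

variable {col}

theorem mem_proj {S : Finset (Fin n)} {t : Finset V} {a : V} :
    a ∈ proj col S t ↔ a ∈ t ∧ col a ∈ S := by simp [proj]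

theorem proj_proj_of_subset {S S' : Finset (Fin n)} (h : S ⊆ S') (t : Finset V) :
    proj col S (proj col S' t) = proj col S t := by
  ext a
  simp only [mem_proj]
  exact ⟨fun ha => ⟨ha.1.1, ha.2⟩, fun ha => ⟨⟨ha.1, h ha.2⟩, ha.2⟩⟩

theorem DependsOnColors.mono {Γ : Type*} {S S' : Finset (Fin n)} {g : Finset V → Γ}
    (hg : DependsOnColors col S g) (h : S ⊆ S') : DependsOnColors col S' g := fun t => by
  rw [← hg (proj col S' t), proj_proj_of_subset h, hg]

theorem dependsOnColors_const {Γ : Type*} (S : Finset (Fin n)) (x : Γ) :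
    DependsOnColors col S fun _ => x := fun _ => rfl

theorem DependsOnColors.mul {Γ : Type*} [Group Γ] {S : Finset (Fin n)} {f g : Finset V → Γ}
    (hf : DependsOnColors col S f) (hg : DependsOnColors col S g) :
    DependsOnColors col S fun t => f t * g t := fun t => by simp only [hf t, hg t]

theorem DependsOnColors.inv {Γ : Type*} [Group Γ] {S : Finset (Fin n)} {f : Finset V → Γ}
    (hf : DependsOnColors col S f) : DependsOnColors col S fun t => (f t)⁻¹ :=
  fun t => by simp only [hf t]

variable (col) in
/-- The vertex of `t` of colour `i` (arbitrary if there is none). -/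
noncomputable def vertexOf [Nonempty V] (t : Finset V) (i : Fin n) : V :=
  Classical.epsilon fun a => a ∈ t ∧ col a = i

theorem vertexOf_spec [Nonempty V] {t : Finset V} {i : Fin n} (h : ∃ a, a ∈ t ∧ col a = i) :
    vertexOf col t i ∈ t ∧ col (vertexOf col t i) = i := Classical.epsilon_spec h

theorem vertexOf_congr [Nonempty V] {t t' : Finset V} {i : Fin n}
    (h : ∀ a, col a = i → (a ∈ t ↔ a ∈ t')) : vertexOf col t i = vertexOf col t' i := by
  unfold vertexOf
  congr 1
  ext a
  exact ⟨fun ha => ⟨(h a ha.2).1 ha.1, ha.2⟩, fun ha => ⟨(h a ha.2).2 ha.1, ha.2⟩⟩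

end Colors

/-! ### From expansion of links to potentials for families of functions on `X`. -/

section Partite

variable {V : Type v} [Fintype V] {X : WeightedComplex V} {n : ℕ} {col : V → Fin n}

theorem IsPartite.eq_of_col_eq (hX : X.IsPartite col) {t : Finset V} (ht : 0 < X.weight t)
    {a b : V} (ha : a ∈ t) (hb : b ∈ t) (h : col a = col b) : a = b :=
  (hX t ht (col b)).unique ⟨ha, h⟩ ⟨hb, rfl⟩

theorem IsPartite.vertexOf_spec [Nonempty V] (hX : X.IsPartite col) {t : Finset V}
    (ht : 0 < X.weight t) (i : Fin n) :
    vertexOf col t i ∈ t ∧ col (vertexOf col t i) = i :=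
  WeightedComplex.vertexOf_spec (hX t ht i).exists

theorem IsPartite.vertexOf_eq [Nonempty V] (hX : X.IsPartite col) {t : Finset V}
    (ht : 0 < X.weight t) {a : V} (ha : a ∈ t) : vertexOf col t (col a) = a :=
  hX.eq_of_col_eq ht (hX.vertexOf_spec ht _).1 ha (hX.vertexOf_spec ht _).2

/-- Each colour occurs exactly once in a top-level face, so conditioning on containing a face of
colours `S` is conditioning on the `S`-part. -/
theorem IsPartite.subset_iff_proj_eq (hX : X.IsPartite col) {S : Finset (Fin n)}
    {t₀ t : Finset V} (ht₀ : 0 < X.weight t₀) (ht : 0 < X.weight t) :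
    proj col S t₀ ⊆ t ↔ proj col S t = proj col S t₀ := by
  refine ⟨fun h => ?_, fun h => h ▸ Finset.filter_subset _ _⟩
  ext a
  simp only [mem_proj]
  constructor
  · rintro ⟨ha, hc⟩
    obtain ⟨b, hb, hbc⟩ := (hX t₀ ht₀ (col a)).exists
    have hbt : b ∈ t := h (mem_proj.2 ⟨hb, hbc ▸ hc⟩)
    have := hX.eq_of_col_eq ht hbt ha hbc
    exact ⟨this ▸ hb, hc⟩
  · rintro ⟨ha, hc⟩
    exact ⟨h (mem_proj.2 ⟨ha, hc⟩), hc⟩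

/-- With the `S`-part `w` frozen, `φ j k` depends only on the vertices of colours `i j` and `i k`,
so it is a cochain on `X_w^I`. Both sides carry the same factor `1 / X.upWeight w`, which cancels.
-/
theorem IsPartite.exists_coboundary_in_link [Nonempty V] (hX : X.IsPartite col)
    {ℓ : ℕ} [NeZero ℓ] {i : Fin ℓ → Fin n} (hi : Function.Injective i) {S : Finset (Fin n)}
    (hS : ∀ j, i j ∉ S) {β : ℝ} (hβ : 0 < β)
    (hexp : ∀ (w : Finset V) (hw : X.IsFace w), (∀ a ∈ w, col a ∈ S) →
      IsCoboundaryExpander.{u} ((X.link w hw).restrict col (Finset.univ.image i)) β)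
    {Γ : Type u} [Group Γ] (φ : Fin ℓ → Fin ℓ → Finset V → Γ)
    (hanti : ∀ j k t, φ j k t = (φ k j t)⁻¹)
    (hdep : ∀ j k, DependsOnColors col (insert (i j) (insert (i k) S)) (φ j k))
    {t₀ : Finset V} (ht₀ : 0 < X.weight t₀) :
    ∃ h : V → Γ,
      β * ((∑ j, ∑ k, X.pr fun t => proj col S t = proj col S t₀ ∧ j ≠ k ∧
        φ j k t ≠ h (vertexOf col t (i j)) * (h (vertexOf col t (i k)))⁻¹)
          / ((ℓ.choose 2 : ℝ) * 2))
      ≤ (∑ j, ∑ k, ∑ m, X.pr fun t => proj col S t = proj col S t₀ ∧ (j ≠ k ∧ k ≠ m ∧ j ≠ m) ∧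
        φ j k t * φ k m t * φ m j t ≠ 1) / ((ℓ.choose 3 : ℝ) * 6) := by
  classical
  set w := proj col S t₀ with hw_def
  have hw : X.IsFace w := ⟨t₀, ht₀, Finset.filter_subset _ _⟩
  have hwS : ∀ a ∈ w, col a ∈ S := fun a ha => (mem_proj.1 ha).2
  have hiw : ∀ a j, col a = i j → a ∉ w := fun a j ha haw => hS j (ha ▸ hwS a haw)
  let idx : Fin n → Fin ℓ := Function.invFun i
  have hidx : ∀ j, idx (i j) = j := Function.leftInverse_invFun hi
  -- On the relevant faces `w ∪ {a, b}` is the whole part of `t` that `φ` sees.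
  let f : V → V → Γ := fun a b => φ (idx (col a)) (idx (col b)) (w ∪ {a, b})
  have hf : ((X.link w hw).restrict col (Finset.univ.image i)).IsCochain f := by
    intro a b _
    simp only [f]
    rw [hanti, Finset.pair_comm]
  obtain ⟨h, hh⟩ := (isCoboundaryExpander_iff _ hβ).1 (hexp w hw hwS) Γ f hf
  refine ⟨h, ?_⟩
  have hlink : ∀ t, 0 < (X.link w hw).weight t →
      Function.Injective (fun j => vertexOf col t (i j)) ∧
      ∀ a, a ∈ t.filter (fun a => col a ∈ Finset.univ.image i) ↔
        ∃ j, vertexOf col t (i j) = a := by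
    intro t ht
    obtain ⟨hd, ht'⟩ := link_weight_pos X ht
    have hex : ∀ j, vertexOf col t (i j) ∈ t ∧ col (vertexOf col t (i j)) = i j := by
      intro j
      obtain ⟨a, ha, hac⟩ := (hX _ ht' (i j)).exists
      refine WeightedComplex.vertexOf_spec ⟨a, ?_, hac⟩
      exact (Finset.mem_union.1 ha).resolve_right (hiw a j hac)
    refine ⟨fun j k hjk => hi ?_, fun a => ?_⟩
    · rw [← (hex j).2, ← (hex k).2]
      exact congrArg col hjk
    · simp only [Finset.mem_filter, Finset.mem_image, Finset.mem_univ, true_and]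
      constructor
      · rintro ⟨hat, j, hj⟩
        refine ⟨j, hX.eq_of_col_eq ht' (Finset.mem_union_left _ (hex j).1)
          (Finset.mem_union_left _ hat) ((hex j).2.trans hj)⟩
      · rintro ⟨j, rfl⟩
        exact ⟨(hex j).1, j, (hex j).2.symm⟩
  rw [restrict, dist_map _ hlink, deltaWeight_map _ hlink] at hh
  have hv : ∀ t j, vertexOf col (t \ w) (i j) = vertexOf col t (i j) := fun t j =>
    vertexOf_congr fun a ha => by simp [hiw a j ha]
  have hfφ : ∀ t, 0 < X.weight t → proj col S t = w → ∀ j k,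
      f (vertexOf col t (i j)) (vertexOf col t (i k)) = φ j k t := by
    intro t ht htw j k
    simp only [f]
    rw [(hX.vertexOf_spec ht (i j)).2, (hX.vertexOf_spec ht (i k)).2, hidx, hidx,
      ← hdep j k t]
    congr 1
    ext a
    simp only [← htw, Finset.mem_union, mem_proj, Finset.mem_insert, Finset.mem_singleton]
    constructor
    · rintro (⟨ha, hc⟩ | rfl | rfl)
      · exact ⟨ha, Or.inr (Or.inr hc)⟩
      · exact ⟨(hX.vertexOf_spec ht _).1, Or.inl (hX.vertexOf_spec ht _).2⟩
      · exact ⟨(hX.vertexOf_spec ht _).1, Or.inr (Or.inl (hX.vertexOf_spec ht _).2)⟩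
    · rintro ⟨ha, hc | hc | hc⟩
      · right; left; rw [← hc, hX.vertexOf_eq ht ha]
      · right; right; rw [← hc, hX.vertexOf_eq ht ha]
      · exact Or.inl ⟨ha, hc⟩
  have h2 : ∀ j k, (X.link w hw).pr (fun t => j ≠ k ∧
        f (vertexOf col t (i j)) (vertexOf col t (i k))
          ≠ h (vertexOf col t (i j)) * (h (vertexOf col t (i k)))⁻¹)
      = (X.pr fun t => proj col S t = w ∧ j ≠ k ∧
        φ j k t ≠ h (vertexOf col t (i j)) * (h (vertexOf col t (i k)))⁻¹) / X.upWeight w := by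
    intro j k
    rw [link_pr]
    congr 1
    refine X.pr_congr fun t ht => ?_
    rw [hX.subset_iff_proj_eq ht₀ ht]
    refine and_congr_right fun htw => ?_
    rw [hv, hv, hfφ t ht htw]
  have h3 : ∀ j k m, (X.link w hw).pr (fun t => (j ≠ k ∧ k ≠ m ∧ j ≠ m) ∧
        delta f (vertexOf col t (i j)) (vertexOf col t (i k)) (vertexOf col t (i m)) ≠ 1)
      = (X.pr fun t => proj col S t = w ∧ (j ≠ k ∧ k ≠ m ∧ j ≠ m) ∧
        φ j k t * φ k m t * φ m j t ≠ 1) / X.upWeight w := by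
    intro j k m
    rw [link_pr]
    congr 1
    refine X.pr_congr fun t ht => ?_
    rw [hX.subset_iff_proj_eq ht₀ ht]
    refine and_congr_right fun htw => ?_
    rw [hv, hv, hv, delta, hfφ t ht htw, hfφ t ht htw, hfφ t ht htw]
  simp only [h2, h3, ← Finset.sum_div] at hh
  rw [div_right_comm, div_right_comm (c := (ℓ.choose 3 : ℝ) * 6), ← mul_div_assoc,
    div_le_div_iff_of_pos_right (X.upWeight_pos hw)] at hh
  exact hh

/-- The inequalities of the links add up over the possible `S`-parts `w`. The solutions glue because
`H j` may read off `w` from the colours in `S`. -/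
theorem IsPartite.averaged_expansion (hX : X.IsPartite col)
    {ℓ : ℕ} [NeZero ℓ] {i : Fin ℓ → Fin n} (hi : Function.Injective i) {S : Finset (Fin n)}
    (hS : ∀ j, i j ∉ S) {β : ℝ} (hβ : 0 < β)
    (hexp : ∀ (w : Finset V) (hw : X.IsFace w), (∀ a ∈ w, col a ∈ S) →
      IsCoboundaryExpander.{u} ((X.link w hw).restrict col (Finset.univ.image i)) β)
    {Γ : Type u} [Group Γ] (φ : Fin ℓ → Fin ℓ → Finset V → Γ)
    (hanti : ∀ j k t, φ j k t = (φ k j t)⁻¹)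
    (hdep : ∀ j k, DependsOnColors col (insert (i j) (insert (i k) S)) (φ j k)) :
    ∃ H : Fin ℓ → Finset V → Γ, (∀ j, DependsOnColors col (insert (i j) S) (H j)) ∧
      β * ((∑ j, ∑ k, X.pr fun t => j ≠ k ∧ φ j k t ≠ H j t * (H k t)⁻¹)
          / ((ℓ.choose 2 : ℝ) * 2))
      ≤ (∑ j, ∑ k, ∑ m, X.pr fun t => (j ≠ k ∧ k ≠ m ∧ j ≠ m) ∧
        φ j k t * φ k m t * φ m j t ≠ 1) / ((ℓ.choose 3 : ℝ) * 6) := by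
  classical
  obtain ⟨t₁, ht₁⟩ := X.exists_weight_pos
  have : Nonempty V := ⟨(hX t₁ ht₁ (i 0)).exists.choose⟩
  have key : ∀ w : Finset V, ∃ h : V → Γ,
      β * ((∑ j, ∑ k, X.pr fun t => proj col S t = w ∧ j ≠ k ∧
        φ j k t ≠ h (vertexOf col t (i j)) * (h (vertexOf col t (i k)))⁻¹)
          / ((ℓ.choose 2 : ℝ) * 2))
      ≤ (∑ j, ∑ k, ∑ m, X.pr fun t => proj col S t = w ∧ (j ≠ k ∧ k ≠ m ∧ j ≠ m) ∧
        φ j k t * φ k m t * φ m j t ≠ 1) / ((ℓ.choose 3 : ℝ) * 6) := by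
    intro w
    by_cases h : ∃ t₀, 0 < X.weight t₀ ∧ proj col S t₀ = w
    · obtain ⟨t₀, ht₀, rfl⟩ := h
      exact hX.exists_coboundary_in_link hi hS hβ hexp φ hanti hdep ht₀
    · push Not at h
      refine ⟨fun _ => 1, ?_⟩
      have h0 : ∀ p : Finset V → Prop, (X.pr fun t => proj col S t = w ∧ p t) = 0 :=
        fun p => X.pr_eq_zero fun t ht hp => h t ht hp.1
      simp only [h0]
      simp
  choose h hh using key
  refine ⟨fun j t => h (proj col S t) (vertexOf col t (i j)), fun j t => ?_, ?_⟩
  · simp only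
    rw [proj_proj_of_subset (Finset.subset_insert _ _)]
    congr 1
    refine vertexOf_congr fun a ha => ?_
    simp [mem_proj, ha]
  · have h2 : ∀ j k, (X.pr fun t => j ≠ k ∧ φ j k t ≠ h (proj col S t) (vertexOf col t (i j))
          * (h (proj col S t) (vertexOf col t (i k)))⁻¹)
        = ∑ w, X.pr fun t => proj col S t = w ∧ j ≠ k ∧
          φ j k t ≠ h w (vertexOf col t (i j)) * (h w (vertexOf col t (i k)))⁻¹ := by
      intro j k
      rw [X.pr_fiberwise (proj col S)]
      refine Finset.sum_congr rfl fun w _ => X.pr_congr fun t _ => ?_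
      refine and_congr_right fun htw => ?_
      rw [htw]
    have h3 : ∀ j k m, (X.pr fun t => (j ≠ k ∧ k ≠ m ∧ j ≠ m) ∧
          φ j k t * φ k m t * φ m j t ≠ 1)
        = ∑ w, X.pr fun t => proj col S t = w ∧ (j ≠ k ∧ k ≠ m ∧ j ≠ m) ∧
          φ j k t * φ k m t * φ m j t ≠ 1 := fun j k m => X.pr_fiberwise (proj col S) _
    simp only [h2, h3]
    rw [sum_comm_pair, sum_comm_triple, Finset.sum_div, Finset.sum_div, Finset.mul_sum]
    exact Finset.sum_le_sum fun w _ => hh w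

/-- A uniform version of `IsPartite.averaged_expansion`. -/
theorem IsPartite.exists_potential (hX : X.IsPartite col)
    {ℓ : ℕ} (hℓ : 3 ≤ ℓ) {i : Fin ℓ → Fin n} (hi : Function.Injective i) {S : Finset (Fin n)}
    (hS : ∀ j, i j ∉ S) {β : ℝ} (hβ : 0 < β)
    (hexp : ∀ (w : Finset V) (hw : X.IsFace w), (∀ a ∈ w, col a ∈ S) →
      IsCoboundaryExpander.{u} ((X.link w hw).restrict col (Finset.univ.image i)) β)
    {Γ : Type u} [Group Γ] (φ : Fin ℓ → Fin ℓ → Finset V → Γ)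
    (hanti : ∀ j k t, φ j k t = (φ k j t)⁻¹)
    (hdep : ∀ j k, DependsOnColors col (insert (i j) (insert (i k) S)) (φ j k))
    {D : ℝ} (hφ : ∀ j k m, (X.pr fun t => φ j k t * φ k m t * φ m j t ≠ 1) ≤ D) :
    ∃ H : Fin ℓ → Finset V → Γ, (∀ j, DependsOnColors col (insert (i j) S) (H j)) ∧
      ∀ j k, j ≠ k → β * (X.pr fun t => φ j k t ≠ H j t * (H k t)⁻¹) ≤ (ℓ : ℝ) ^ 5 * D := by
  classical
  have : NeZero ℓ := ⟨by omega⟩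
  obtain ⟨H, hH, hle⟩ := hX.averaged_expansion hi hS hβ hexp φ hanti hdep
  refine ⟨H, hH, fun j k hjk => ?_⟩
  have hD : 0 ≤ D := (X.pr_nonneg _).trans (hφ 0 0 0)
  have hN2 := one_le_choose_two_mul hℓ
  have hN2' := choose_two_mul_le ℓ
  have hN3 := one_le_choose_three_mul hℓ
  have h3 : (∑ j, ∑ k, ∑ m, X.pr fun t => (j ≠ k ∧ k ≠ m ∧ j ≠ m) ∧
      φ j k t * φ k m t * φ m j t ≠ 1) ≤ (ℓ : ℝ) ^ 3 * D := by
    calc _ ≤ ∑ _j : Fin ℓ, ∑ _k : Fin ℓ, ∑ _m : Fin ℓ, D :=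
          Finset.sum_le_sum fun j _ => Finset.sum_le_sum fun k _ => Finset.sum_le_sum fun m _ =>
            (X.pr_mono fun t _ h => h.2).trans (hφ j k m)
      _ = (ℓ : ℝ) ^ 3 * D := by simp; ring
  have h2 : (X.pr fun t => φ j k t ≠ H j t * (H k t)⁻¹)
      ≤ ∑ j, ∑ k, X.pr fun t => j ≠ k ∧ φ j k t ≠ H j t * (H k t)⁻¹ := by
    refine (X.pr_mono fun t _ h => ⟨hjk, h⟩ : _ ≤
      X.pr fun t => j ≠ k ∧ φ j k t ≠ H j t * (H k t)⁻¹).trans ?_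
    refine (Finset.single_le_sum (f := fun k => X.pr fun t => j ≠ k ∧
      φ j k t ≠ H j t * (H k t)⁻¹) (fun _ _ => X.pr_nonneg _) (Finset.mem_univ k)).trans ?_
    exact Finset.single_le_sum (f := fun j => ∑ k, X.pr fun t => j ≠ k ∧
      φ j k t ≠ H j t * (H k t)⁻¹)
      (fun _ _ => Finset.sum_nonneg fun _ _ => X.pr_nonneg _) (Finset.mem_univ j)
  have h4 := hle.trans ((div_le_self (Finset.sum_nonneg fun _ _ => Finset.sum_nonneg fun _ _ =>
    Finset.sum_nonneg fun _ _ => X.pr_nonneg _) hN3).trans h3)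
  rw [← mul_div_assoc, div_le_iff₀ (by linarith)] at h4
  -- The fifth power of `ℓ` comes from at most `ℓ ^ 3` triples and the normalization of at most `ℓ ^
  -- 2` ordered pairs.
  calc _ ≤ _ := mul_le_mul_of_nonneg_left h2 hβ.le
    _ ≤ _ := h4
    _ ≤ (ℓ : ℝ) ^ 3 * D * (ℓ : ℝ) ^ 2 := by gcongr
    _ = _ := by ring

theorem mul_inv_cyclic {Γ : Type*} [Group Γ] (x y z : Γ) :
    x * y⁻¹ * (y * z⁻¹) * (z * x⁻¹) = 1 := by group

/-- Take the constant cochain with value an involution `z`. Around a triangle it multiplies to `z ^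
3 = z ≠ 1`, whereas a coboundary gives `1`. So any coboundary misses it on one of the three edges of
every triangle, while expansion bounds each of these failure probabilities by `ℓ ^ 5 / β`. -/
theorem IsPartite.expansion_le (hX : X.IsPartite col)
    {ℓ : ℕ} (hℓ : 3 ≤ ℓ) {i : Fin ℓ → Fin n} (hi : Function.Injective i) {β : ℝ} (hβ : 0 < β)
    (hexp : ∀ (w : Finset V) (hw : X.IsFace w), (∀ a ∈ w, col a ∈ (∅ : Finset (Fin n))) →
      IsCoboundaryExpander.{u} ((X.link w hw).restrict col (Finset.univ.image i)) β) :
    β ≤ 3 * (ℓ : ℝ) ^ 5 := by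
  classical
  let Γ := ULift.{u} (Multiplicative (ZMod 2))
  let z : Γ := ⟨Multiplicative.ofAdd 1⟩
  have hz : z * z = 1 := by decide
  have hz1 : z ≠ 1 := by decide
  have hzi : z = z⁻¹ := eq_inv_of_mul_eq_one_left hz
  obtain ⟨H, -, hH⟩ := hX.exists_potential hℓ hi (S := ∅) (fun j => by simp) hβ hexp
    (fun _ _ _ => z) (fun _ _ _ => hzi) (fun _ _ => dependsOnColors_const _ _) (D := 1)
    (fun j k m => (X.pr_mono fun _ _ _ => trivial).trans X.pr_true.le)
  let a : Fin ℓ := ⟨0, by omega⟩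
  let b : Fin ℓ := ⟨1, by omega⟩
  let c : Fin ℓ := ⟨2, by omega⟩
  have h1 := hH a b (by simp [a, b])
  have h2 := hH b c (by simp [b, c])
  have h3 := hH c a (by simp [a, c])
  have h : 1 ≤ (X.pr fun t => z ≠ H a t * (H b t)⁻¹) + ((X.pr fun t => z ≠ H b t * (H c t)⁻¹)
      + X.pr fun t => z ≠ H c t * (H a t)⁻¹) := by
    rw [← X.pr_true]
    refine (X.pr_le_add (r := fun t => z ≠ H b t * (H c t)⁻¹ ∨ z ≠ H c t * (H a t)⁻¹)
      (q := fun t => z ≠ H a t * (H b t)⁻¹) fun t _ _ => ?_).trans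
      (add_le_add_right (X.pr_le_add fun t _ h => h) _)
    by_contra! hne
    obtain ⟨e1, e2, e3⟩ := hne
    apply hz1
    calc z = z * z * z := by rw [hz, one_mul]
      _ = (H a t * (H b t)⁻¹) * (H b t * (H c t)⁻¹) * (H c t * (H a t)⁻¹) := by
        rw [← e1, ← e2, ← e3]
      _ = 1 := mul_inv_cyclic _ _ _
  nlinarith

end Partite

/-! ### Adding one colour of `c j` to the set of fixed colours. -/

section Next

variable {n ℓ : ℕ}

open Classical in
/-- A set containing one chosen element of `s`, and empty if `s` is empty. -/
noncomputable def pick (s : Finset (Fin n)) : Finset (Fin n) :=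
  if h : s.Nonempty then {h.choose} else ∅

theorem pick_eq_singleton {s : Finset (Fin n)} (h : s.Nonempty) : ∃ i ∈ s, pick s = {i} :=
  ⟨h.choose, h.choose_spec, by simp [pick, h]⟩

theorem pick_subset (s : Finset (Fin n)) : pick s ⊆ s := by
  by_cases h : s.Nonempty
  · obtain ⟨i, hi, h'⟩ := pick_eq_singleton h
    simpa [h'] using hi
  · simp [pick, h]

/-- Adjoin to `T` a chosen element of `c j \ T`. -/
noncomputable def next (c : Fin ℓ → Finset (Fin n)) (T : Finset (Fin n)) (j : Fin ℓ) :
    Finset (Fin n) := T ∪ pick (c j \ T)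

variable {c : Fin ℓ → Finset (Fin n)}

theorem subset_next (T : Finset (Fin n)) (j : Fin ℓ) : T ⊆ next c T j := Finset.subset_union_left

theorem next_subset {T U : Finset (Fin n)} (hT : T ⊆ U) {j : Fin ℓ} (hc : c j ⊆ U) :
    next c T j ⊆ U :=
  Finset.union_subset hT ((pick_subset _).trans (Finset.sdiff_subset.trans hc))

/-- Disjointness keeps the choice in `c k` unaffected by the one in `c j`. The result is symmetric
in `j` and `k`, so the two orders of extension meet at the same set and share one family of
potentials. -/
theorem next_next (hc : Pairwise fun j k => Disjoint (c j) (c k)) (T : Finset (Fin n))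
    {j k : Fin ℓ} (hjk : j ≠ k) :
    next c (next c T j) k = T ∪ pick (c j \ T) ∪ pick (c k \ T) := by
  have : c k \ next c T j = c k \ T := by
    refine (Finset.sdiff_subset_sdiff subset_rfl (subset_next T j)).antisymm fun a ha => ?_
    rw [Finset.mem_sdiff] at ha ⊢
    refine ⟨ha.1, fun h => ?_⟩
    have := (Finset.mem_sdiff.1 (pick_subset _ ((Finset.mem_union.1 h).resolve_left ha.2))).1
    exact Finset.disjoint_left.1 (hc hjk) this ha.1
  rw [next, this, next]

theorem card_sdiff_next {T U : Finset (Fin n)} {j : Fin ℓ} (hcU : c j ⊆ U) (hT : ¬ c j ⊆ T) :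
    (U \ T).card = (U \ next c T j).card + 1 := by
  obtain ⟨i, hi, hpi⟩ := pick_eq_singleton (Finset.sdiff_nonempty.2 hT)
  rw [Finset.mem_sdiff] at hi
  have : U \ next c T j = (U \ T).erase i := by
    rw [next, hpi]; ext a; simp; tauto
  rw [this, Finset.card_erase_add_one]
  exact Finset.mem_sdiff.2 ⟨hcU hi.1, hi.2⟩

end Next

/-! ### Approximate potentials by downward recursion on the fixed colours. -/

section System

variable {V : Type v} [Fintype V] {X : WeightedComplex V} {n ℓ : ℕ} {col : V → Fin n}
  {c : Fin ℓ → Finset (Fin n)} {Γ : Type u} [Group Γ]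
  {F : Fin ℓ → Fin ℓ → Finset V → Γ} {U : Finset (Fin n)} {K A τ : ℝ}

variable (X col c F U K τ) in
/-- `p` is, after fixing the vertices with colours in `T`, an approximate potential of `F`; up to
the right factors `g j` it agrees with the potentials `h (next c T j)`. -/
structure IsPotentialAt (h : Finset (Fin n) → Fin ℓ → Finset V → Γ) (T : Finset (Fin n))
    (p g : Fin ℓ → Finset V → Γ) : Prop where
  dep : ∀ j, DependsOnColors col (T ∪ c j) (p j)
  dep_factor : ∀ j, DependsOnColors col (next c T j) (g j)
  close : ∀ j k, j ≠ k →
    (X.pr fun t => F j k t ≠ p j t * (p k t)⁻¹) ≤ 4 * K ^ (U \ T).card * τ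
  compat : ∀ j m, (X.pr fun t => p m t ≠ h (next c T j) m t * g j t) ≤ K ^ (U \ T).card * τ

variable (X col c U A Γ) in
/-- Approximate cocycles on the colours `i j ∈ c j`, over fixed vertices with colours in `T`, are
close to coboundaries. -/
def HasPotentials : Prop :=
  ∀ (T : Finset (Fin n)) (i : Fin ℓ → Fin n), T ⊆ U → (∀ j, i j ∈ c j) → (∀ j, i j ∉ T) →
    ∀ φ : Fin ℓ → Fin ℓ → Finset V → Γ, (∀ j k t, φ j k t = (φ k j t)⁻¹) →
      (∀ j k, DependsOnColors col (insert (i j) (insert (i k) T)) (φ j k)) →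
      ∀ D : ℝ, (∀ j k m, (X.pr fun t => φ j k t * φ k m t * φ m j t ≠ 1) ≤ D) →
        ∃ H : Fin ℓ → Finset V → Γ, (∀ j, DependsOnColors col (insert (i j) T) (H j)) ∧
          ∀ j k, j ≠ k → (X.pr fun t => φ j k t ≠ H j t * (H k t)⁻¹) ≤ A * D

/-- The factors `g` of the larger sets combine into an approximate cocycle on the new colours, and
its potential `H` corrects the families over `next c T j` so that they nearly agree. The same `H`
serves as the factor at `T`, which keeps the recursion going. -/
theorem IsPotentialAt.extend (hc : Pairwise fun j k => Disjoint (c j) (c k))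
    (hcU : ∀ j, c j ⊆ U) (hexp : HasPotentials X col c Γ U A) (hτ : 0 ≤ τ)
    (hK : 2 ≤ K) (hKA : 2 + 6 * A ≤ K)
    {h g : Finset (Fin n) → Fin ℓ → Finset V → Γ} {T : Finset (Fin n)} (hTU : T ⊆ U)
    (hT : ∀ j, ¬ c j ⊆ T)
    (hgood : ∀ j, IsPotentialAt X col c F U K τ h (next c T j) (h (next c T j)) (g (next c T j))) :
    ∃ p q : Fin ℓ → Finset V → Γ, IsPotentialAt X col c F U K τ h T p q := by
  classical
  have hpick : ∀ j, ∃ i ∈ c j \ T, pick (c j \ T) = {i} := fun j =>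
    pick_eq_singleton (Finset.sdiff_nonempty.2 (hT j))
  choose i hi hpi using hpick
  have hic : ∀ j, i j ∈ c j := fun j => (Finset.mem_sdiff.1 (hi j)).1
  have hiT : ∀ j, i j ∉ T := fun j => (Finset.mem_sdiff.1 (hi j)).2
  have hnext : ∀ j, next c T j = insert (i j) T := fun j => by
    rw [next, hpi, Finset.union_comm, Finset.insert_eq]
  have hnn : ∀ j k, j ≠ k → next c (next c T j) k = insert (i j) (insert (i k) T) := by
    intro j k hjk
    rw [next_next hc T hjk, hpi, hpi]
    ext a; simp
  have hcard : ∀ j, (U \ T).card = (U \ next c T j).card + 1 := fun j =>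
    card_sdiff_next (hcU j) (hT j)
  set E : ℝ := K ^ ((U \ T).card - 1) * τ with hE
  have hE0 : 0 ≤ E := mul_nonneg (pow_nonneg (by linarith) _) hτ
  have hlow : ∀ j, K ^ (U \ next c T j).card * τ = E := fun j => by
    rw [hE, hcard j, Nat.add_sub_cancel]
  have hpos : 0 < ℓ → K ^ (U \ T).card * τ = K * E := fun hℓ => by
    rw [hE, hcard ⟨0, hℓ⟩, Nat.add_sub_cancel, pow_succ]; ring
  -- The discrepancy of the families over `next c T j` and `next c T k`, routed through their common
  -- extension: the potential there cancels and leaves only the two factors.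
  let φ : Fin ℓ → Fin ℓ → Finset V → Γ := fun j k t =>
    if j = k then 1 else (g (next c T j) k t)⁻¹ * g (next c T k) j t
  have hanti : ∀ j k t, φ j k t = (φ k j t)⁻¹ := by
    intro j k t
    by_cases hjk : j = k
    · simp [φ, hjk]
    · simp [φ, hjk, Ne.symm hjk]
  have hdep : ∀ j k, DependsOnColors col (insert (i j) (insert (i k) T)) (φ j k) := by
    intro j k
    by_cases hjk : j = k
    · simp only [φ, hjk, if_true]
      exact dependsOnColors_const _ _
    · simp only [φ, hjk, if_false]
      have h1 := (hgood j).dep_factor k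
      have h2 := (hgood k).dep_factor j
      rw [hnn j k hjk] at h1
      rw [hnn k j (Ne.symm hjk), Finset.insert_comm] at h2
      exact h1.inv.mul h2
  have htrans : ∀ j k m, (X.pr fun t => φ j k t ≠ (h (next c T j) m t)⁻¹ * h (next c T k) m t)
      ≤ 2 * E := by
    intro j k m
    by_cases hjk : j = k
    · rw [X.pr_eq_zero]
      · linarith
      · intro t _ hne
        apply hne
        simp [φ, hjk]
    · have h1 := (hgood j).compat k m
      have h2 := (hgood k).compat j m
      rw [hlow, hnn j k hjk] at h1
      rw [hlow, hnn k j (Ne.symm hjk), Finset.insert_comm] at h2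
      refine (X.pr_le_add fun t _ hne => ?_).trans ((add_le_add h1 h2).trans_eq (by ring))
      by_contra! hcon
      apply hne
      rw [hcon.1, hcon.2]
      simp [φ, hjk, mul_assoc]
  -- All three discrepancies are evaluated at the same index `j`, so that the product telescopes;
  -- each costs `2 * E`.
  have htri : ∀ j k m, (X.pr fun t => φ j k t * φ k m t * φ m j t ≠ 1) ≤ 6 * E := by
    intro j k m
    have h12 := add_le_add (add_le_add (htrans j k j) (htrans k m j)) (htrans m j j)
    refine (X.pr_le_add fun t _ hne => ?_).trans ((add_le_add_left (X.pr_le_add fun t _ hor =>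
      hor) _).trans (h12.trans_eq (by ring)))
    by_contra! hcon
    obtain ⟨⟨e1, e2⟩, e3⟩ := hcon
    apply hne
    rw [e1, e2, e3]
    group
  obtain ⟨H, hH, hHφ⟩ := hexp T i hTU hic hiT φ hanti hdep (6 * E) htri
  have hA : ∀ j k : Fin ℓ, j ≠ k → 0 ≤ A * (6 * E) := fun j k hjk =>
    (X.pr_nonneg _).trans (hHφ j k hjk)
  have hcompat : ∀ j m, (X.pr fun t => h (next c T m) m t * H m t ≠ h (next c T j) m t * H j t)
      ≤ K ^ (U \ T).card * τ := by
    intro j m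
    have hℓ : 0 < ℓ := j.pos
    by_cases hjm : j = m
    · rw [X.pr_eq_zero]
      · rw [hpos hℓ]
        exact mul_nonneg (by linarith) hE0
      · intro t _ hne
        apply hne
        rw [hjm]
    · rw [hpos hℓ]
      refine (X.pr_le_add fun t _ hne => ?_).trans ((add_le_add (htrans j m m)
        (hHφ j m hjm)).trans ?_)
      · by_contra! hcon
        obtain ⟨e1, e2⟩ := hcon
        rw [e2] at e1
        apply hne
        have e3 : h (next c T m) m t = h (next c T j) m t * (H j t * (H m t)⁻¹) := by
          rw [e1]; group
        rw [e3]; group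
      · nlinarith
  -- The `j`-th potential is taken from the `j`-th family: there the extra colour `i j` already lies
  -- in `c j`.
  refine ⟨fun j t => h (next c T j) j t * H j t, H, ⟨fun j => ?_, fun j => ?_, ?_, hcompat⟩⟩
  · refine DependsOnColors.mul ?_ ((hH j).mono ?_)
    · refine ((hgood j).dep j).mono (Finset.union_subset ?_ Finset.subset_union_right)
      rw [hnext]
      exact Finset.insert_subset (Finset.mem_union_right _ (hic j)) Finset.subset_union_left
    · exact Finset.insert_subset (Finset.mem_union_right _ (hic j)) Finset.subset_union_left
  · rw [hnext]
    exact hH j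
  · intro j k hjk
    have hℓ : 0 < ℓ := j.pos
    have h1 := (hgood j).close j k hjk
    rw [mul_assoc, hlow] at h1
    have h2 := hcompat j k
    refine (X.pr_le_add fun t _ hne => ?_).trans ((add_le_add h1 h2).trans ?_)
    · by_contra! hcon
      apply hne
      rw [hcon.2, hcon.1]
      group
    -- The total is `4 * E + K * E`, at most `4 * K * E` since `K ≥ 2`.
    · rw [mul_assoc, hpos hℓ]
      nlinarith

/-- A chosen index `j` with `c j ⊆ T`. -/
noncomputable def apex [NeZero ℓ] (c : Fin ℓ → Finset (Fin n)) (T : Finset (Fin n)) : Fin ℓ :=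
  Classical.epsilon fun j => c j ⊆ T

theorem apex_spec [NeZero ℓ] {T : Finset (Fin n)} (h : ∃ j, c j ⊆ T) : c (apex c T) ⊆ T :=
  Classical.epsilon_spec h

/-- Both conditions are the approximate cocycle identity: cones with different apexes differ by the
right factor `F` between the apexes, which sees only fixed colours. -/
theorem isPotentialAt_apex [NeZero ℓ] (hFanti : ∀ j k t, F j k t = (F k j t)⁻¹)
    (hFdep : ∀ j k, DependsOnColors col (c j ∪ c k) (F j k)) (hτ0 : 0 ≤ τ)
    (hτ : ∀ j k m, (X.pr fun t => F j k t * F k m t ≠ F j m t) ≤ τ) (hK : 2 ≤ K)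
    {h : Finset (Fin n) → Fin ℓ → Finset V → Γ}
    (hh : ∀ T, (∃ j, c j ⊆ T) → h T = fun k => F k (apex c T))
    {T : Finset (Fin n)} (hT : ∃ j, c j ⊆ T) :
    IsPotentialAt X col c F U K τ h T (h T) fun j => F (apex c (next c T j)) (apex c T) := by
  have hKτ : τ ≤ K ^ (U \ T).card * τ := le_mul_of_one_le_left hτ0 (one_le_pow₀ (by linarith))
  have hTn : ∀ j, ∃ k, c k ⊆ next c T j := fun j =>
    hT.imp fun k hk => hk.trans (subset_next T j)
  refine ⟨fun j => ?_, fun j => ?_, fun j k _ => ?_, fun j m => ?_⟩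
  · rw [hh T hT]
    exact (hFdep _ _).mono (Finset.union_subset Finset.subset_union_right
      ((apex_spec hT).trans Finset.subset_union_left))
  · exact (hFdep _ _).mono (Finset.union_subset (apex_spec (hTn j))
      ((apex_spec hT).trans (subset_next T j)))
  · rw [hh T hT]
    refine (X.pr_mono fun t _ hne => ?_).trans ((hτ j (apex c T) k).trans (by linarith))
    rw [hFanti (apex c T) k]
    exact hne.symm
  · rw [hh T hT, hh _ (hTn j)]
    refine (X.pr_mono fun t _ hne => ?_).trans ((hτ m (apex c (next c T j)) (apex c T)).trans hKτ)
    exact hne.symm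

theorem exists_isPotentialAt [NeZero ℓ] (hc : Pairwise fun j k => Disjoint (c j) (c k))
    (hcU : ∀ j, c j ⊆ U) (hexp : HasPotentials X col c Γ U A)
    (hFanti : ∀ j k t, F j k t = (F k j t)⁻¹)
    (hFdep : ∀ j k, DependsOnColors col (c j ∪ c k) (F j k)) (hτ0 : 0 ≤ τ)
    (hτ : ∀ j k m, (X.pr fun t => F j k t * F k m t ≠ F j m t) ≤ τ)
    (hK : 2 ≤ K) (hKA : 2 + 6 * A ≤ K) (s : ℕ) :
    ∃ h g : Finset (Fin n) → Fin ℓ → Finset V → Γ,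
      (∀ T, (∃ j, c j ⊆ T) → h T = fun k => F k (apex c T)) ∧
      ∀ T ⊆ U, (U \ T).card ≤ s → IsPotentialAt X col c F U K τ h T (h T) (g T) := by
  classical
  induction s with
  | zero =>
    refine ⟨fun T k => F k (apex c T), fun T j => F (apex c (next c T j)) (apex c T),
      fun _ _ => rfl, fun T hTU hs => ?_⟩
    -- Only `T = U` is left, and it contains `c 0`.
    refine isPotentialAt_apex hFanti hFdep hτ0 hτ hK (fun _ _ => rfl) ⟨0, (hcU 0).trans ?_⟩
    rw [← Finset.sdiff_eq_empty_iff_subset]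
    exact Finset.card_eq_zero.1 (Nat.le_zero.1 hs)
  | succ s ih =>
    obtain ⟨h, g, hbase, hgood⟩ := ih
    have hstep : ∀ T, ∃ p q : Fin ℓ → Finset V → Γ, T ⊆ U → (∀ j, ¬ c j ⊆ T) →
        (U \ T).card = s + 1 → IsPotentialAt X col c F U K τ h T p q := by
      intro T
      by_cases hT : T ⊆ U ∧ (∀ j, ¬ c j ⊆ T) ∧ (U \ T).card = s + 1
      · obtain ⟨hTU, hTc, hTs⟩ := hT
        have : ∀ j, (U \ next c T j).card ≤ s := by
          intro j
          have := card_sdiff_next (hcU j) (hTc j)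
          omega
        obtain ⟨p, q, hpq⟩ := IsPotentialAt.extend hc hcU hexp hτ0 hK hKA hTU hTc fun j =>
          hgood _ (next_subset hTU (hcU j)) (this j)
        exact ⟨p, q, fun _ _ _ => hpq⟩
      · exact ⟨h T, h T, fun h1 h2 h3 => absurd ⟨h1, h2, h3⟩ hT⟩
    choose p q hpq using hstep
    -- Only the new level is overwritten: compatibility at a non-cone `T` refers to potentials one
    -- level closer to `U`, which must stay as they are.
    let h' : Finset (Fin n) → Fin ℓ → Finset V → Γ := fun T =>
      if (∀ j, ¬ c j ⊆ T) ∧ (U \ T).card = s + 1 then p T else h T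
    let g' : Finset (Fin n) → Fin ℓ → Finset V → Γ := fun T =>
      if ∃ j, c j ⊆ T then fun j => F (apex c (next c T j)) (apex c T)
      else if (U \ T).card = s + 1 then q T else g T
    have hbase' : ∀ T, (∃ j, c j ⊆ T) → h' T = fun k => F k (apex c T) := by
      intro T hT
      rw [← hbase T hT]
      exact if_neg fun hn => hT.elim hn.1
    refine ⟨h', g', hbase', fun T hTU hs => ?_⟩
    by_cases hT : ∃ j, c j ⊆ T
    · have hg : g' T = fun j => F (apex c (next c T j)) (apex c T) := if_pos hT
      rw [hg]
      exact isPotentialAt_apex hFanti hFdep hτ0 hτ hK hbase' hT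
    · have hT' : ∀ j, ¬ c j ⊆ T := not_exists.1 hT
      have hnext : ∀ j, h' (next c T j) = h (next c T j) := by
        intro j
        refine if_neg fun hn => ?_
        have := card_sdiff_next (hcU j) (hT' j)
        omega
      by_cases hcard : (U \ T).card = s + 1
      · have h1 : h' T = p T := if_pos ⟨hT', hcard⟩
        have h2 : g' T = q T := by simp only [g', if_neg hT, if_pos hcard]
        have h3 := hpq T hTU hT' hcard
        rw [h1, h2]
        exact ⟨h3.dep, h3.dep_factor, h3.close, fun j m => by rw [hnext]; exact h3.compat j m⟩
      · have h1 : h' T = h T := if_neg fun hn => hcard hn.2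
        have h2 : g' T = g T := by simp only [g', if_neg hT, if_neg hcard]
        have h3 := hgood T hTU (by omega)
        rw [h1, h2]
        exact ⟨h3.dep, h3.dep_factor, h3.close, fun j m => by rw [hnext]; exact h3.compat j m⟩

theorem HasPotentials.exists_potential [NeZero ℓ]
    (hc : Pairwise fun j k => Disjoint (c j) (c k))
    (hexp : HasPotentials X col c Γ (Finset.univ.biUnion c) A)
    (hFanti : ∀ j k t, F j k t = (F k j t)⁻¹)
    (hFdep : ∀ j k, DependsOnColors col (c j ∪ c k) (F j k)) (hτ0 : 0 ≤ τ)
    (hτ : ∀ j k m, (X.pr fun t => F j k t * F k m t ≠ F j m t) ≤ τ)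
    (hK : 2 ≤ K) (hKA : 2 + 6 * A ≤ K) :
    ∃ h : Fin ℓ → Finset V → Γ, (∀ j, DependsOnColors col (c j) (h j)) ∧
      ∀ j k, j ≠ k →
        (X.pr fun t => F j k t ≠ h j t * (h k t)⁻¹) ≤ 4 * K ^ (∑ j, (c j).card) * τ := by
  classical
  obtain ⟨h, g, -, hgood⟩ := exists_isPotentialAt hc
    (fun j => Finset.subset_biUnion_of_mem c (Finset.mem_univ j)) hexp hFanti hFdep hτ0 hτ hK hKA
    (Finset.univ.biUnion c \ ∅).card
  have h0 := hgood ∅ (Finset.empty_subset _) le_rfl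
  refine ⟨h ∅, fun j => by simpa using h0.dep j, fun j k hjk => ?_⟩
  have h1 := h0.close j k hjk
  rwa [Finset.sdiff_empty, Finset.card_biUnion fun x _ y _ hxy => hc hxy] at h1

end System

/-! ### Cochains of the faces complex as functions on top-level faces of `X`. -/

section EdgeValue

variable {V : Type v} {n ℓ : ℕ} {col : V → Fin n} {c : Fin ℓ → Finset (Fin n)}
  {Γ : Type u} [Group Γ]

variable (col c) in
/-- The values of a cochain of the coloured faces complex on the edges of a top-level face. -/
noncomputable def edgeValue (f : Fin ℓ × Finset V → Fin ℓ × Finset V → Γ) (j k : Fin ℓ)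
    (t : Finset V) : Γ :=
  if j = k then 1
  else if j < k then f (j, proj col (c j) t) (k, proj col (c k) t)
  else (f (k, proj col (c k) t) (j, proj col (c j) t))⁻¹

theorem edgeValue_self (f : Fin ℓ × Finset V → Fin ℓ × Finset V → Γ) (j : Fin ℓ)
    (t : Finset V) : edgeValue col c f j j t = 1 := if_pos rfl

theorem edgeValue_symm (f : Fin ℓ × Finset V → Fin ℓ × Finset V → Γ) (j k : Fin ℓ)
    (t : Finset V) : edgeValue col c f j k t = (edgeValue col c f k j t)⁻¹ := by
  unfold edgeValue
  rcases lt_trichotomy j k with h | h | h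
  · simp [h, h.ne, h.ne', h.not_gt]
  · simp [h]
  · simp [h, h.ne, h.ne', h.not_gt]

theorem dependsOnColors_edgeValue (f : Fin ℓ × Finset V → Fin ℓ × Finset V → Γ) (j k : Fin ℓ) :
    DependsOnColors col (c j ∪ c k) (edgeValue col c f j k) := fun t => by
  simp only [edgeValue, proj_proj_of_subset (Finset.subset_union_left (s₁ := c j) (s₂ := c k)),
    proj_proj_of_subset (Finset.subset_union_right (s₁ := c j) (s₂ := c k))]

open Classical in
theorem facesComplex_param (t : Finset V) :
    Function.Injective (fun j : Fin ℓ => (j, proj col (c j) t)) ∧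
      ∀ a, a ∈ (Finset.univ.image fun j : Fin ℓ => (j, t.filter fun a => col a ∈ c j)) ↔
        ∃ j, (j, proj col (c j) t) = a :=
  ⟨fun _ _ h => congrArg Prod.fst h, fun a => by simp [proj]⟩

end EdgeValue

/-! ### Expansion of the faces complex. -/

section FacesComplex

variable {V : Type v} [Fintype V] {X : WeightedComplex V} {n ℓ : ℕ} {col : V → Fin n}
  {c : Fin ℓ → Finset (Fin n)} {Γ : Type u} [Group Γ]

/-- `edgeValue` is antisymmetric for every `t`, whereas `f` is so only on edges; on faces of
positive weight the pairs in question are edges. -/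
theorem edgeValue_eq {f : Fin ℓ × Finset V → Fin ℓ × Finset V → Γ}
    (hf : (X.facesComplex col c).IsCochain f) {t : Finset V} (ht : 0 < X.weight t) {j k : Fin ℓ}
    (hjk : j ≠ k) :
    edgeValue col c f j k t = f (j, proj col (c j) t) (k, proj col (c k) t) := by
  classical
  rcases lt_or_gt_of_ne hjk with h | h
  · simp [edgeValue, h, hjk]
  · rw [edgeValue, if_neg hjk, if_neg h.not_gt]
    refine (hf _ _ ⟨fun he => hjk (congrArg Prod.fst he), ?_⟩).symm
    refine (map_isFace_iff X).2 ⟨t, ht, ?_⟩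
    intro a ha
    simp only [Finset.mem_insert, Finset.mem_singleton] at ha
    rw [Finset.mem_image]
    rcases ha with rfl | rfl
    · exact ⟨j, Finset.mem_univ j, rfl⟩
    · exact ⟨k, Finset.mem_univ k, rfl⟩

theorem facesComplex_dist (h : Fin ℓ → Finset V → Γ)
    (hdep : ∀ j, DependsOnColors col (c j) (h j))
    {f : Fin ℓ × Finset V → Fin ℓ × Finset V → Γ} (hf : (X.facesComplex col c).IsCochain f) :
    (X.facesComplex col c).dist f (fun a b => h a.1 a.2 * (h b.1 b.2)⁻¹)
      = (∑ j, ∑ k, X.pr fun t => j ≠ k ∧ edgeValue col c f j k t ≠ h j t * (h k t)⁻¹)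
        / ((ℓ.choose 2 : ℝ) * 2) := by
  classical
  rw [facesComplex, X.dist_map (e := fun t j => (j, proj col (c j) t))
    fun t _ => facesComplex_param t]
  congr 1
  refine Finset.sum_congr rfl fun j _ => Finset.sum_congr rfl fun k _ => X.pr_congr fun t ht =>
    and_congr_right fun hjk => ?_
  rw [edgeValue_eq hf ht hjk]
  simp only [hdep j t, hdep k t]

theorem facesComplex_deltaWeight {f : Fin ℓ × Finset V → Fin ℓ × Finset V → Γ}
    (hf : (X.facesComplex col c).IsCochain f) :
    (X.facesComplex col c).deltaWeight f
      = (∑ j, ∑ k, ∑ m, X.pr fun t => (j ≠ k ∧ k ≠ m ∧ j ≠ m) ∧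
          edgeValue col c f j k t * edgeValue col c f k m t ≠ edgeValue col c f j m t)
        / ((ℓ.choose 3 : ℝ) * 6) := by
  classical
  rw [facesComplex, X.deltaWeight_map (e := fun t j => (j, proj col (c j) t))
    fun t _ => facesComplex_param t]
  congr 1
  refine Finset.sum_congr rfl fun j _ => Finset.sum_congr rfl fun k _ =>
    Finset.sum_congr rfl fun m _ => X.pr_congr fun t ht => and_congr_right fun hd => ?_
  rw [edgeValue_symm f j m, edgeValue_eq hf ht hd.1, edgeValue_eq hf ht hd.2.1,
    edgeValue_eq hf ht hd.2.2.symm, delta, ne_eq, ne_eq, mul_eq_one_iff_eq_inv]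

/-- The coloured faces complex of empty sets of colours is a single simplex. -/
theorem exists_potential_of_forall_eq_empty (hℓ : 3 ≤ ℓ) (hc : ∀ j, c j = ∅)
    {f : Fin ℓ × Finset V → Fin ℓ × Finset V → Γ} (hf : (X.facesComplex col c).IsCochain f) :
    ∃ h : Fin ℓ × Finset V → Γ, (X.facesComplex col c).dist f (fun a b => h a * (h b)⁻¹)
      ≤ (X.facesComplex col c).deltaWeight f := by
  classical
  have : NeZero ℓ := ⟨by omega⟩
  set P : Fin ℓ → Fin ℓ → Fin ℓ → ℝ := fun j k m => X.pr fun t => (j ≠ k ∧ k ≠ m ∧ j ≠ m) ∧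
    edgeValue col c f j k t * edgeValue col c f k m t ≠ edgeValue col c f j m t with hP
  have hℓ0 : (0 : ℝ) < ℓ := by exact_mod_cast (by omega : 0 < ℓ)
  -- Some apex `m` does at least as well as the average over all `ℓ` of them; this saving is what
  -- makes the constant exactly `1`.
  obtain ⟨m, -, hm⟩ : ∃ m ∈ (Finset.univ : Finset (Fin ℓ)),
      ∑ j, ∑ k, P j k m ≤ (∑ j, ∑ k, ∑ m, P j k m) / ℓ := by
    refine Finset.exists_le_of_sum_le Finset.univ_nonempty ?_
    rw [← sum_comm_pair]
    simp only [Finset.sum_const, Finset.card_univ, Fintype.card_fin, nsmul_eq_mul]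
    rw [mul_div_cancel₀ _ hℓ0.ne']
  refine ⟨fun a => edgeValue col c f a.1 m a.2, ?_⟩
  have hdep : ∀ j, DependsOnColors col (c j) (edgeValue col c f j m) := fun j =>
    (dependsOnColors_edgeValue f j m).mono (by simp [hc])
  rw [facesComplex_dist _ hdep hf, facesComplex_deltaWeight hf]
  have hle : ∑ j, ∑ k, X.pr (fun t => j ≠ k ∧ edgeValue col c f j k t
      ≠ edgeValue col c f j m t * (edgeValue col c f k m t)⁻¹) ≤ ∑ j, ∑ k, P j k m := by
    refine Finset.sum_le_sum fun j _ => Finset.sum_le_sum fun k _ => X.pr_mono ?_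
    rintro t - ⟨hjk, hne⟩
    refine ⟨⟨hjk, ?_, ?_⟩, fun h => hne (eq_mul_inv_of_mul_eq h)⟩
    · rintro rfl
      exact hne (by simp [edgeValue_self])
    · rintro rfl
      exact hne (by rw [edgeValue_self, one_mul, edgeValue_symm])
  have hN2 := one_le_choose_two_mul hℓ
  have hN3 := one_le_choose_three_mul hℓ
  have hS : 0 ≤ ∑ j, ∑ k, ∑ m, P j k m := Finset.sum_nonneg fun _ _ => Finset.sum_nonneg
    fun _ _ => Finset.sum_nonneg fun _ _ => X.pr_nonneg _
  calc _ ≤ ((∑ j, ∑ k, ∑ m, P j k m) / ℓ) / ((ℓ.choose 2 : ℝ) * 2) := by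
        gcongr
        exact hle.trans hm
    _ = (∑ j, ∑ k, ∑ m, P j k m) / (ℓ * ((ℓ.choose 2 : ℝ) * 2)) := by rw [div_div]
    _ ≤ _ := div_le_div_of_nonneg_left hS (by linarith) (choose_three_mul_le ℓ)

/-- The recursion works with bounds uniform in the indices. Passing from the averaged coboundary
weight to a uniform bound costs `ℓ ^ 3`, and summing the errors over pairs costs `ℓ ^ 2`. -/
theorem HasPotentials.exists_facesComplex_potential (hℓ : 3 ≤ ℓ)
    (hc : Pairwise fun j k => Disjoint (c j) (c k)) {A K : ℝ}
    (hexp : HasPotentials X col c Γ (Finset.univ.biUnion c) A)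
    (hK : 2 ≤ K) (hKA : 2 + 6 * A ≤ K)
    {f : Fin ℓ × Finset V → Fin ℓ × Finset V → Γ} (hf : (X.facesComplex col c).IsCochain f) :
    ∃ h : Fin ℓ × Finset V → Γ, (X.facesComplex col c).dist f (fun a b => h a * (h b)⁻¹)
      ≤ 4 * (ℓ : ℝ) ^ 5 * K ^ (∑ j, (c j).card) * (X.facesComplex col c).deltaWeight f := by
  classical
  have : NeZero ℓ := ⟨by omega⟩
  have hN2 := one_le_choose_two_mul hℓ
  have hN3 := one_le_choose_three_mul hℓ
  have hℓ0 : (0 : ℝ) ≤ ℓ := Nat.cast_nonneg _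
  have hN3' : (ℓ.choose 3 : ℝ) * 6 ≤ (ℓ : ℝ) ^ 3 := by
    refine (choose_three_mul_le ℓ).trans ?_
    calc _ ≤ (ℓ : ℝ) * (ℓ : ℝ) ^ 2 := mul_le_mul_of_nonneg_left (choose_two_mul_le ℓ) hℓ0
      _ = _ := by ring
  set P : Fin ℓ → Fin ℓ → Fin ℓ → ℝ := fun j k m => X.pr fun t => (j ≠ k ∧ k ≠ m ∧ j ≠ m) ∧
    edgeValue col c f j k t * edgeValue col c f k m t ≠ edgeValue col c f j m t with hP
  have hP0 : ∀ j k m, 0 ≤ P j k m := fun _ _ _ => X.pr_nonneg _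
  set τ : ℝ := ∑ j, ∑ k, ∑ m, P j k m with hτdef
  have hτ0 : 0 ≤ τ := Finset.sum_nonneg fun _ _ => Finset.sum_nonneg
    fun _ _ => Finset.sum_nonneg fun _ _ => hP0 _ _ _
  have hτ : ∀ j k m, (X.pr fun t => edgeValue col c f j k t * edgeValue col c f k m t
      ≠ edgeValue col c f j m t) ≤ τ := by
    intro j k m
    have hPτ : P j k m ≤ τ := by
      refine (Finset.single_le_sum (f := fun m => P j k m) (fun _ _ => hP0 _ _ _)
        (Finset.mem_univ m)).trans ?_
      refine (Finset.single_le_sum (f := fun k => ∑ m, P j k m)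
        (fun _ _ => Finset.sum_nonneg fun _ _ => hP0 _ _ _) (Finset.mem_univ k)).trans ?_
      exact Finset.single_le_sum (f := fun j => ∑ k, ∑ m, P j k m)
        (fun _ _ => Finset.sum_nonneg fun _ _ => Finset.sum_nonneg fun _ _ => hP0 _ _ _)
        (Finset.mem_univ j)
    -- Degenerate triples satisfy the cocycle identity exactly.
    refine (X.pr_mono fun t _ hne => ⟨⟨?_, ?_, ?_⟩, hne⟩).trans hPτ
    · rintro rfl
      exact hne (by rw [edgeValue_self, one_mul])
    · rintro rfl
      exact hne (by rw [edgeValue_self, mul_one])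
    · rintro rfl
      exact hne (by rw [edgeValue_self, edgeValue_symm f j k, inv_mul_cancel])
  obtain ⟨h, hdep, hh⟩ := hexp.exists_potential hc (edgeValue_symm f)
    (dependsOnColors_edgeValue f) hτ0 hτ hK hKA
  refine ⟨fun a => h a.1 a.2, ?_⟩
  rw [facesComplex_dist _ hdep hf, facesComplex_deltaWeight hf]
  have hB : 0 ≤ 4 * K ^ (∑ j, (c j).card) * τ :=
    mul_nonneg (mul_nonneg zero_le_four (pow_nonneg (by linarith) _)) hτ0
  have hsum : ∑ j, ∑ k, X.pr (fun t => j ≠ k ∧ edgeValue col c f j k t ≠ h j t * (h k t)⁻¹)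
      ≤ (ℓ : ℝ) ^ 2 * (4 * K ^ (∑ j, (c j).card) * τ) := by
    calc _ ≤ ∑ _j : Fin ℓ, ∑ _k : Fin ℓ, 4 * K ^ (∑ j, (c j).card) * τ := by
          refine Finset.sum_le_sum fun j _ => Finset.sum_le_sum fun k _ => ?_
          by_cases hjk : j = k
          · rw [X.pr_eq_zero fun t _ hne => hne.1 hjk]
            exact hB
          · exact (X.pr_mono fun t _ hne => hne.2).trans (hh j k hjk)
      _ = _ := by
          simp only [Finset.sum_const, Finset.card_univ, Fintype.card_fin, nsmul_eq_mul]
          ring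
  have hτle : τ ≤ (ℓ : ℝ) ^ 3 * (τ / ((ℓ.choose 3 : ℝ) * 6)) := by
    rw [← mul_div_assoc, le_div_iff₀ (by linarith), mul_comm]
    exact mul_le_mul_of_nonneg_right hN3' hτ0
  calc _ ≤ ∑ j, ∑ k, X.pr (fun t => j ≠ k ∧ edgeValue col c f j k t ≠ h j t * (h k t)⁻¹) :=
        div_le_self (Finset.sum_nonneg fun _ _ => Finset.sum_nonneg fun _ _ => X.pr_nonneg _) hN2
    _ ≤ _ := hsum
    _ = 4 * (ℓ : ℝ) ^ 2 * K ^ (∑ j, (c j).card) * τ := by ring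
    _ ≤ 4 * (ℓ : ℝ) ^ 2 * K ^ (∑ j, (c j).card)
          * ((ℓ : ℝ) ^ 3 * (τ / ((ℓ.choose 3 : ℝ) * 6))) := by
        refine mul_le_mul_of_nonneg_left hτle ?_
        exact mul_nonneg (by positivity) (pow_nonneg (by linarith) _)
    _ = _ := by ring

end FacesComplex

end WeightedComplex

/-! ### The choice of constants. -/

theorem mainTheorem10 (ℓ : ℕ) (hℓ : 5 ≤ ℓ) :
    ∃ C : ℝ, 0 < C ∧
      ∀ (V : Type v) [Fintype V] (n r : ℕ) (X : WeightedComplex V) (col : V → Fin n) (lam β : ℝ)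
        (c : Fin ℓ → Finset (Fin n)),
        X.IsPartite col →
        X.IsLocalSpectralExpander n lam →
        2 * (r : ℝ) ^ 2 * lam ≤ 1 →
        Pairwise (fun j k => Disjoint (c j) (c k)) →
        (∀ j, (c j).card ≤ r) →
        0 < β →
        ((∃ j, c j = ∅) → β ≤ 1) →
        (∀ (i : Fin ℓ → Fin n), (∀ j, i j ∈ c j) →
          ∀ (w : Finset V) (hw : X.IsFace w),
            (∀ a ∈ w, col a ∈ Finset.univ.biUnion c \ Finset.univ.image i) →
            WeightedComplex.IsCoboundaryExpander.{u}
              ((X.link w hw).restrict col (Finset.univ.image i)) β) →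
        WeightedComplex.IsCoboundaryExpander.{u}
          (X.facesComplex col c) ((C * β) ^ (∑ j, (c j).card)) := by
  have hℓ3 : 3 ≤ ℓ := by omega
  have hℓ0 : (1 : ℝ) ≤ (ℓ : ℝ) ^ 5 := one_le_pow₀ (by exact_mod_cast (by omega : 1 ≤ ℓ))
  set q : ℝ := (ℓ : ℝ) ^ 5 with hq
  -- Here `48 * q ^ 2` is the product of the prefactor `4 * q` and the numerator `12 * q` of `K`.
  refine ⟨1 / (48 * q ^ 2), by positivity, ?_⟩
  intro V _ n r X col lam β c hX _ _ hc _ hβ hempty hexp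
  have hinj : ∀ i : Fin ℓ → Fin n, (∀ j, i j ∈ c j) → Function.Injective i := by
    intro i hi j k hjk
    by_contra hne
    exact Finset.disjoint_left.1 (hc hne) (hi j) (hjk ▸ hi k)
  -- An upper bound on `β` lets the additive `2` in `2 + 6 * A ≤ K` be absorbed into a multiple of
  -- `1 / β`. With an empty `c j` there is no choice of colours to derive it from, hence the
  -- separate bound.
  have hβq : β ≤ 3 * q := by
    by_cases h : ∃ j, c j = ∅
    · linarith [hempty h]
    · have hne : ∀ j, (c j).Nonempty := fun j =>
        Finset.nonempty_iff_ne_empty.2 fun h' => h ⟨j, h'⟩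
      choose i hi using hne
      refine hX.expansion_le hℓ3 (hinj i hi) hβ fun w hw hwc => hexp i hi w hw fun a ha => ?_
      exact absurd (hwc a ha) (Finset.notMem_empty _)
  rw [WeightedComplex.isCoboundaryExpander_iff _ (by positivity)]
  intro Γ _ f hf
  -- For `R = 0` the required constant is exactly `1`, with no power to absorb the prefactor.
  by_cases hR : ∑ j, (c j).card = 0
  · obtain ⟨h, hh⟩ := WeightedComplex.exists_potential_of_forall_eq_empty hℓ3 (fun j => Finset.card_eq_zero.1
      (Finset.sum_eq_zero_iff.1 hR j (Finset.mem_univ j))) hf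
    exact ⟨h, by rwa [hR, pow_zero, one_mul]⟩
  have hpot : WeightedComplex.HasPotentials X col c Γ (Finset.univ.biUnion c) (q / β) := by
    intro T i hTU hi hiT φ hanti hdep D hD
    obtain ⟨H, hH, hle⟩ := hX.exists_potential hℓ3 (hinj i hi) hiT hβ (fun w hw hwT =>
      hexp i hi w hw fun a ha => Finset.mem_sdiff.2 ⟨hTU (hwT a ha), fun him => by
        obtain ⟨j, -, hj⟩ := Finset.mem_image.1 him
        exact hiT j (hj ▸ hwT a ha)⟩) φ hanti hdep hD
    refine ⟨H, hH, fun j k hjk => ?_⟩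
    rw [div_mul_eq_mul_div, le_div_iff₀ hβ, mul_comm]
    exact hle j k hjk
  have h1 : 1 ≤ 3 * q / β := (one_le_div hβ).2 hβq
  have h2 : 12 * q / β = 4 * (3 * q / β) := by ring
  have h3 : q / β = (3 * q / β) / 3 := by ring
  -- With `A = q / β` and `3 * A ≥ 1`, the choice `K = 12 * A` gives `2 + 6 * A ≤ K`.
  obtain ⟨h, hh⟩ := hpot.exists_facesComplex_potential hℓ3 hc (K := 12 * q / β) (by linarith)
    (by linarith) hf
  refine ⟨h, ?_⟩
  set R := ∑ j, (c j).card
  have hwt : 0 ≤ (X.facesComplex col c).deltaWeight f := by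
    rw [WeightedComplex.facesComplex_deltaWeight hf]
    exact div_nonneg (Finset.sum_nonneg fun _ _ => Finset.sum_nonneg fun _ _ =>
      Finset.sum_nonneg fun _ _ => X.pr_nonneg _) (by positivity)
  have h4 : 4 * q * (12 * q / β) ^ R ≤ (4 * q * (12 * q / β)) ^ R := by
    rw [mul_pow]
    exact mul_le_mul_of_nonneg_right (le_self_pow₀ (by linarith) hR) (by positivity)
  calc (1 / (48 * q ^ 2) * β) ^ R * _
      ≤ (1 / (48 * q ^ 2) * β) ^ R * ((4 * q * (12 * q / β)) ^ R
          * (X.facesComplex col c).deltaWeight f) := by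
        refine mul_le_mul_of_nonneg_left (hh.trans ?_) (by positivity)
        exact mul_le_mul_of_nonneg_right h4 hwt
    _ = (X.facesComplex col c).deltaWeight f := by
        rw [← mul_assoc, ← mul_pow]
        have : 1 / (48 * q ^ 2) * β * (4 * q * (12 * q / β)) = 1 := by
          field_simp
          norm_num
        rw [this, one_pow, one_mul]
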